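/- Let $N\ge 1$. An $N\times N$ input-queued switch has $N^2$ queues, one for each pair $i=(i_1,i_2)$ of an input port $i_1$ and an output port $i_2$. Write $row(i)$ (resp. $col(i)$) for the set of queues other than $i$ with the same input port (resp. output port) as $i$, and $other(i)$ for the set of the remaining queues different from $i$. Let $\mathcal S$ be the set of $x\in\{0,1\}^{N^2}$ with at most one entry equal to 1 for each input port and at most one for each output port. In time slot $k$ a schedule $s(k)\in\arg\max_{x\in\mathcal S}\langle q(k),x\rangle$ is chosen (MaxWeight; ties are broken by an arbitrary random rule depending on $q(k)$), then a vector $a(k)\in\mathbb Z_+^{N^2}$ of packets arrives, and then $q(k+1)=\max\{q(k)+a(k)-s(k),0\}$ componentwise. The vectors $a(k)$ are i.i.d. in $k$ and independent of the queue lengths and schedules up to slot $k$; their entries may be correlated. Let $\nu\in\mathbb R^{N^2}$ have positive entries and be completely saturated: for each input port and for each output port, the entries $\nu_i$ of its queues sum to 1. Consider such switches parametrized by $\epsilon\in(0,1)$, where the arrival vector $a^{(\epsilon)}$ of a slot has mean $(1-\epsilon)\nu$, entries bounded by a constant $A_{\max}$ that does not depend on $\epsilon$, and covariance matrix $\Sigma_a^{(\epsilon)}$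 with $\lim_{\epsilon\downarrow0}\Sigma_a^{(\epsilon)}=\Sigma_a$ componentwise. Put $\sigma_{a_i}^2=(\Sigma_a)_{i,i}$. Then for every $\epsilon\in(0,1)$ the Markov chain $q^{(\epsilon)}(k)$ has a stationary distribution, and whenever $\overline q^{(\epsilon)}$ is a steady-state vector (a random vector with a stationary distribution) for each $\epsilon\in(0,1)$, then $E\big[\sum_i\overline q_i^{(\epsilon)}\big]<\infty$ for all $\epsilon\in(0,1)$ and $$\lim_{\epsilon\downarrow 0}\epsilon\,E\Big[\sum_{i}\overline q_i^{(\epsilon)}\Big]=\frac1{2N}\sum_{i}\Big((2N-1)\sigma_{a_i}^2+(N-1)\sum_{j\in row(i)\cup col(i)}(\Sigma_a)_{i,j}-\sum_{j\in other(i)}(\Sigma_a)_{i,j}\Big).$$ -/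

import Mathlib

open Filter Topology MeasureTheory ProbabilityTheory

namespace InputQueuedSwitch

/-- A vector of natural numbers with one entry for each input/output pair of an `N × N` switch:
entry `(i, j)` belongs to the queue of packets waiting at input port `i` for output port `j`.
Queue lengths, arrivals and services are vectors of this kind. -/
abbrev QVec (N : ℕ) : Type := Fin N × Fin N → ℕ

/-- The set of feasible service vectors: vectors with entries in `{0, 1}`, with at most one active
queue for each input port (row) and at most one for each output port (column). -/
def schedules (N : ℕ) : Set (QVec N) :=
  {x | (∀ p, x p = 0 ∨ x p = 1) ∧ (∀ i, ∑ j, x (i, j) ≤ 1) ∧ (∀ j, ∑ i, x (i, j) ≤ 1)}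

/-- The inner product of the queue lengths with a schedule. -/
def weight {N : ℕ} (q x : QVec N) : ℕ := ∑ p, q p * x p

/-- The feasible schedules of largest weight when the queue lengths are `q`. -/
def maxWeightSchedules {N : ℕ} (q : QVec N) : Set (QVec N) :=
  {x | x ∈ schedules N ∧ ∀ y ∈ schedules N, weight q y ≤ weight q x}

/-- A (randomized) MaxWeight rule: when the queue lengths are `q`, the schedule is drawn from the
law `τ q`, which charges only schedules of largest weight. The law `τ q` says how ties are
broken; for example it can be uniform. -/
def IsMaxWeightRule {N : ℕ} (τ : QVec N → PMF (QVec N)) : Prop :=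
  ∀ q, (τ q).support ⊆ maxWeightSchedules q

/-- Unused service: the positive part of `s - (q + a)` (the subtraction is truncated). -/
def unused {N : ℕ} (q a s : QVec N) : QVec N := fun p => s p - (q p + a p)

/-- Queue lengths in the next time slot: arrivals come before service, so they are the positive
part of `q + a - s` (the subtraction is truncated). -/
def nextQueue {N : ℕ} (q a s : QVec N) : QVec N := fun p => q p + a p - s p

theorem nextQueue_eq {N : ℕ} (q a s : QVec N) (p : Fin N × Fin N) :
    (nextQueue q a s p : ℤ) = q p + a p - s p + unused q a s p := by
  simp only [nextQueue, unused]; omega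

theorem nextQueue_mul_unused {N : ℕ} (q a s : QVec N) (p : Fin N × Fin N) :
    nextQueue q a s p * unused q a s p = 0 := by
  simp only [nextQueue, unused, mul_eq_zero]; omega

/-- One step of the Markov chain of queue lengths started at `q`: the schedule is drawn from `τ q`
and, independently of it, the vector of arrivals from the law `A`. Entries of the arrival vector
may be correlated. -/
noncomputable def step {N : ℕ} (A : PMF (QVec N)) (τ : QVec N → PMF (QVec N)) (q : QVec N) :
    PMF (QVec N) :=
  (τ q).bind fun s => A.map fun a => nextQueue q a s

/-- `π` is a steady-state (stationary) law of the Markov chain of queue lengths. -/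
def IsSteadyState {N : ℕ} (A : PMF (QVec N)) (τ : QVec N → PMF (QVec N)) (π : PMF (QVec N)) :
    Prop :=
  π.bind (step A τ) = π

/-- Queues other than `p` with the same input port. -/
def row {N : ℕ} (p : Fin N × Fin N) : Finset (Fin N × Fin N) :=
  Finset.univ.filter (fun r => r.1 = p.1) \ {p}

/-- Queues other than `p` with the same output port. -/
def col {N : ℕ} (p : Fin N × Fin N) : Finset (Fin N × Fin N) :=
  Finset.univ.filter (fun r => r.2 = p.2) \ {p}

/-- Queues that share neither the input port nor the output port with `p`. -/
def other {N : ℕ} (p : Fin N × Fin N) : Finset (Fin N × Fin N) :=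
  Finset.univ \ (row p ∪ col p ∪ {p})

end InputQueuedSwitch

namespace InputQueuedSwitch

open scoped ENNReal Matrix

section


variable {N : ℕ}

/-- A vector of natural numbers, read as a real vector. -/
def toReal (q : QVec N) : Fin N × Fin N → ℝ := fun p => q p

@[simp] theorem toReal_apply (q : QVec N) (p : Fin N × Fin N) : toReal q p = q p := rfl

/-- The sum of the entries of an input port. -/
def rowSum (x : Fin N × Fin N → ℝ) (i : Fin N) : ℝ := ∑ j, x (i, j)

/-- The sum of the entries of an output port. -/
def colSum (x : Fin N × Fin N → ℝ) (j : Fin N) : ℝ := ∑ i, x (i, j)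

/-- The sum of all entries. -/
def total (x : Fin N × Fin N → ℝ) : ℝ := ∑ p, x p

theorem sum_rowSum (x : Fin N × Fin N → ℝ) : ∑ i, rowSum x i = total x := by
  simp only [rowSum, total, Fintype.sum_prod_type]

theorem sum_colSum (x : Fin N × Fin N → ℝ) : ∑ j, colSum x j = total x := by
  simp only [colSum, total, Fintype.sum_prod_type_right]

/-- Nonnegative vectors whose entries sum to 1 at each port. -/
structure IsBistochastic (x : Fin N × Fin N → ℝ) : Prop where
  nonneg : ∀ p, 0 ≤ x p
  row_eq : ∀ i, rowSum x i = 1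
  col_eq : ∀ j, colSum x j = 1

/-- Nonnegative vectors whose entries sum to at most 1 at each port. -/
structure IsSubstochastic (x : Fin N × Fin N → ℝ) : Prop where
  nonneg : ∀ p, 0 ≤ x p
  row_le : ∀ i, rowSum x i ≤ 1
  col_le : ∀ j, colSum x j ≤ 1

theorem IsBistochastic.total_eq {x : Fin N × Fin N → ℝ} (hx : IsBistochastic x) :
    total x = N := by
  rw [← sum_rowSum]; simp [hx.row_eq]

theorem IsBistochastic.le_one {x : Fin N × Fin N → ℝ} (hx : IsBistochastic x)
    (p : Fin N × Fin N) : x p ≤ 1 := by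
  rw [← hx.row_eq p.1]
  exact Finset.single_le_sum (f := fun j => x (p.1, j)) (fun j _ => hx.nonneg _)
    (Finset.mem_univ p.2)

theorem isSubstochastic_of_mem_schedules {s : QVec N} (hs : s ∈ schedules N) :
    IsSubstochastic (toReal s) where
  nonneg p := by simp
  row_le i := by simp only [rowSum, toReal]; exact_mod_cast hs.2.1 i
  col_le j := by simp only [colSum, toReal]; exact_mod_cast hs.2.2 j

/-- The 0/1 vector of a permutation. -/
def permVec (σ : Equiv.Perm (Fin N)) : QVec N := fun p => if σ p.1 = p.2 then 1 else 0

theorem permVec_mem_schedules (σ : Equiv.Perm (Fin N)) : permVec σ ∈ schedules N := by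
  refine ⟨fun p => ?_, fun i => ?_, fun j => ?_⟩
  · unfold permVec; split_ifs <;> simp
  · simp [permVec]
  · simp [permVec, ← Equiv.eq_symm_apply]

theorem dotProduct_le_of_isBistochastic {q s : QVec N} (hs : s ∈ maxWeightSchedules q)
    {x : Fin N × Fin N → ℝ} (hx : IsBistochastic x) :
    toReal q ⬝ᵥ x ≤ toReal q ⬝ᵥ toReal s := by
  have hM : (Matrix.of fun i j => x (i, j)) ∈ (doublyStochastic ℝ (Fin N) : Set _) := by
    rw [SetLike.mem_coe, mem_doublyStochastic_iff_sum]
    exact ⟨fun i j => hx.nonneg _, hx.row_eq, hx.col_eq⟩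
  rw [doublyStochastic_eq_convexHull_permMatrix] at hM
  set c := toReal q ⬝ᵥ toReal s
  have hconv : Convex ℝ {M : Matrix (Fin N) (Fin N) ℝ | ∑ p, toReal q p * M p.1 p.2 ≤ c} := by
    intro M hM M' hM' a b ha hb hab
    simp only [Set.mem_ofPred_eq, Matrix.add_apply, Matrix.smul_apply, smul_eq_mul] at *
    calc ∑ p, toReal q p * (a * M p.1 p.2 + b * M' p.1 p.2)
        = a * ∑ p, toReal q p * M p.1 p.2 + b * ∑ p, toReal q p * M' p.1 p.2 := by
          simp only [Finset.mul_sum, ← Finset.sum_add_distrib]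
          exact Finset.sum_congr rfl fun p _ => by ring
      _ ≤ a * c + b * c := by gcongr
      _ = c := by rw [← add_mul, hab, one_mul]
  have hsub := convexHull_min (s := {Equiv.Perm.permMatrix ℝ σ | σ : Equiv.Perm (Fin N)})
    (t := {M : Matrix (Fin N) (Fin N) ℝ | ∑ p, toReal q p * M p.1 p.2 ≤ c}) ?_ hconv
  · exact hsub hM
  · rintro _ ⟨σ, rfl⟩
    have h := hs.2 _ (permVec_mem_schedules σ)
    have h' : ((weight q (permVec σ) : ℕ) : ℝ) ≤ (weight q s : ℕ) := by exact_mod_cast h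
    simp only [weight, Nat.cast_sum, Nat.cast_mul] at h'
    refine le_trans (le_of_eq ?_) h'
    refine Finset.sum_congr rfl fun p _ => ?_
    simp [permVec, Equiv.Perm.permMatrix, PEquiv.toMatrix_apply, toReal, eq_comm]

/-- Distributes the unused capacity of the ports so that a substochastic vector becomes
bistochastic. -/
noncomputable def fill (x : Fin N × Fin N → ℝ) : Fin N × Fin N → ℝ := fun p =>
  x p + (1 - rowSum x p.1) * (1 - colSum x p.2) / (N - total x)

theorem IsSubstochastic.total_le {x : Fin N × Fin N → ℝ} (hx : IsSubstochastic x) :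
    total x ≤ N := by
  rw [← sum_rowSum]
  calc ∑ i, rowSum x i ≤ ∑ _i : Fin N, (1 : ℝ) := Finset.sum_le_sum fun i _ => hx.row_le i
    _ = N := by simp

theorem IsSubstochastic.le_fill {x : Fin N × Fin N → ℝ} (hx : IsSubstochastic x)
    (p : Fin N × Fin N) : x p ≤ fill x p := by
  have h1 := hx.row_le p.1
  have h2 := hx.col_le p.2
  have h3 := hx.total_le
  have : 0 ≤ (1 - rowSum x p.1) * (1 - colSum x p.2) / (N - total x) :=
    div_nonneg (mul_nonneg (by linarith) (by linarith)) (by linarith)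
  simp only [fill]; linarith

theorem IsSubstochastic.isBistochastic_fill {x : Fin N × Fin N → ℝ} (hx : IsSubstochastic x) :
    IsBistochastic (fill x) where
  nonneg p := (hx.nonneg p).trans (hx.le_fill p)
  row_eq i := by
    have e : ∑ j, (1 - colSum x j) = N - total x := by simp [sum_colSum]
    have e' : ∑ i, (1 - rowSum x i) = N - total x := by simp [sum_rowSum]
    have : rowSum (fill x) i = rowSum x i + (1 - rowSum x i) * (N - total x) / (N - total x) := by
      rw [← e, Finset.mul_sum, Finset.sum_div]
      simp only [rowSum, fill, Finset.sum_add_distrib, e]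
    rw [this]
    by_cases h : (N : ℝ) - total x = 0
    · rw [h] at e'
      have := (Finset.sum_eq_zero_iff_of_nonneg
        (fun i _ => sub_nonneg.2 (hx.row_le i))).1 e' i (Finset.mem_univ _)
      rw [this, zero_mul, zero_div]; linarith
    · field_simp; ring
  col_eq i := by
    have e : ∑ j, (1 - rowSum x j) = N - total x := by simp [sum_rowSum]
    have e' : ∑ i, (1 - colSum x i) = N - total x := by simp [sum_colSum]
    have : colSum (fill x) i = colSum x i + (N - total x) * (1 - colSum x i) / (N - total x) := by
      rw [← e, Finset.sum_mul, Finset.sum_div]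
      simp only [colSum, fill, Finset.sum_add_distrib, e]
    rw [this]
    by_cases h : (N : ℝ) - total x = 0
    · rw [h] at e'
      have := (Finset.sum_eq_zero_iff_of_nonneg
        (fun i _ => sub_nonneg.2 (hx.col_le i))).1 e' i (Finset.mem_univ _)
      rw [this, mul_zero, zero_div]; linarith
    · field_simp; ring

theorem dotProduct_le_of_isSubstochastic {q s : QVec N} (hs : s ∈ maxWeightSchedules q)
    {x : Fin N × Fin N → ℝ} (hx : IsSubstochastic x) :
    toReal q ⬝ᵥ x ≤ toReal q ⬝ᵥ toReal s := by
  refine le_trans ?_ (dotProduct_le_of_isBistochastic hs hx.isBistochastic_fill)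
  exact Finset.sum_le_sum fun p _ => mul_le_mul_of_nonneg_left (hx.le_fill p) (by simp)

/-- Filling a schedule of largest weight adds service only at empty queues. -/
theorem mul_fill_sub_eq_zero {q s : QVec N} (hs : s ∈ maxWeightSchedules q)
    (p : Fin N × Fin N) : (q p : ℝ) * (fill (toReal s) p - s p) = 0 := by
  have hsub := isSubstochastic_of_mem_schedules hs.1
  have h := dotProduct_le_of_isBistochastic hs hsub.isBistochastic_fill
  have hnn : ∀ p ∈ Finset.univ, 0 ≤ (q p : ℝ) * (fill (toReal s) p - s p) := fun p _ =>
    mul_nonneg (by simp) (sub_nonneg.2 (hsub.le_fill p))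
  refine (Finset.sum_eq_zero_iff_of_nonneg hnn).1 (le_antisymm ?_ (Finset.sum_nonneg hnn)) p
    (Finset.mem_univ p)
  simp only [dotProduct, toReal_apply] at h
  simp only [mul_sub, Finset.sum_sub_distrib]
  linarith

theorem dotProduct_fill_eq {q s : QVec N} (hs : s ∈ maxWeightSchedules q) :
    toReal q ⬝ᵥ fill (toReal s) = toReal q ⬝ᵥ toReal s := by
  refine Finset.sum_congr rfl fun p _ => ?_
  have := mul_fill_sub_eq_zero hs p
  simp only [toReal_apply]; linarith

/-- Idle service relative to the filled schedule. -/
noncomputable def idle (q a s : QVec N) : Fin N × Fin N → ℝ :=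
  toReal (nextQueue q a s) - toReal q - toReal a + fill (toReal s)

theorem idle_apply (q a s : QVec N) (p : Fin N × Fin N) :
    idle q a s p = (fill (toReal s) p - s p) + unused q a s p := by
  have h : ((nextQueue q a s p : ℤ) : ℝ) = ((q p + a p - s p + unused q a s p : ℤ) : ℝ) := by
    rw [nextQueue_eq]
  push_cast at h
  simp only [idle, Pi.add_apply, Pi.sub_apply, toReal_apply, h]
  ring

variable {q a s : QVec N}

theorem idle_nonneg (hs : s ∈ schedules N) (p : Fin N × Fin N) : 0 ≤ idle q a s p := by
  rw [idle_apply]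
  have := (isSubstochastic_of_mem_schedules hs).le_fill p
  simp only [toReal_apply] at this
  have : (0 : ℝ) ≤ unused q a s p := by positivity
  linarith

theorem idle_le_one (hs : s ∈ schedules N) (p : Fin N × Fin N) : idle q a s p ≤ 1 := by
  rw [idle_apply]
  have h1 := (isSubstochastic_of_mem_schedules hs).isBistochastic_fill.le_one p
  have : (unused q a s p : ℝ) ≤ s p := by exact_mod_cast Nat.sub_le _ _
  linarith

theorem queue_mul_idle (hs : s ∈ maxWeightSchedules q) (p : Fin N × Fin N) :
    (q p : ℝ) * idle q a s p = 0 := by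
  rw [idle_apply, mul_add, mul_fill_sub_eq_zero hs, zero_add]
  have h : q p * unused q a s p = 0 := by
    rcases hs.1.1 p with h | h <;> simp only [unused, mul_eq_zero, h] <;> omega
  exact_mod_cast h

theorem nextQueue_mul_idle_le {Amax : ℕ} (hs : s ∈ maxWeightSchedules q)
    (ha : ∀ p, a p ≤ Amax) (p : Fin N × Fin N) :
    (nextQueue q a s p : ℝ) * idle q a s p ≤ Amax * idle q a s p := by
  have h0 := idle_nonneg (q := q) (a := a) hs.1 p
  by_cases hq : q p = 0
  · refine mul_le_mul_of_nonneg_right ?_ h0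
    have : nextQueue q a s p ≤ Amax := by
      simp only [nextQueue, hq]; have := ha p; omega
    exact_mod_cast this
  · have : idle q a s p = 0 := by
      have := queue_mul_idle (a := a) hs p
      simpa [hq] using this
    simp [this]

theorem abs_nextQueue_sub_le {Amax : ℕ} (hs : s ∈ schedules N) (ha : ∀ p, a p ≤ Amax)
    (p : Fin N × Fin N) : |(nextQueue q a s p : ℝ) - q p| ≤ Amax + 1 := by
  have h1 : nextQueue q a s p ≤ q p + Amax := by
    simp only [nextQueue]; have := ha p; omega
  have h2 : q p ≤ nextQueue q a s p + 1 := by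
    simp only [nextQueue]; rcases hs.1 p with h | h <;> omega
  have h1' : (nextQueue q a s p : ℝ) ≤ q p + Amax := by exact_mod_cast h1
  have h2' : (q p : ℝ) ≤ nextQueue q a s p + 1 := by exact_mod_cast h2
  have : (0 : ℝ) ≤ Amax := by positivity
  rw [abs_le]; constructor <;> linarith

end

section


variable {N : ℕ}

/-- The cone of vectors of the form `w i + w' j` with nonnegative `w`, `w'`. -/
def portCone (N : ℕ) : Set (Fin N × Fin N → ℝ) :=
  {y | ∃ w w' : Fin N → ℝ, (∀ i, 0 ≤ w i) ∧ (∀ j, 0 ≤ w' j) ∧ ∀ p, y p = w p.1 + w' p.2}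

theorem nonneg_of_mem_portCone {y : Fin N × Fin N → ℝ} (hy : y ∈ portCone N)
    (p : Fin N × Fin N) : 0 ≤ y p := by
  obtain ⟨w, w', hw, hw', h⟩ := hy
  rw [h]; exact add_nonneg (hw _) (hw' _)

theorem zero_mem_portCone : (0 : Fin N × Fin N → ℝ) ∈ portCone N :=
  ⟨0, 0, by simp, by simp, by simp⟩

theorem add_mem_portCone {y y' : Fin N × Fin N → ℝ} (hy : y ∈ portCone N)
    (hy' : y' ∈ portCone N) : y + y' ∈ portCone N := by
  obtain ⟨w, v, hw, hv, h⟩ := hy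
  obtain ⟨w', v', hw', hv', h'⟩ := hy'
  exact ⟨w + w', v + v', fun i => add_nonneg (hw i) (hw' i), fun i => add_nonneg (hv i) (hv' i),
    fun p => by simp only [Pi.add_apply, h, h']; ring⟩

theorem smul_mem_portCone {y : Fin N × Fin N → ℝ} (hy : y ∈ portCone N) {t : ℝ} (ht : 0 ≤ t) :
    t • y ∈ portCone N := by
  obtain ⟨w, v, hw, hv, h⟩ := hy
  exact ⟨t • w, t • v, fun i => mul_nonneg ht (hw i), fun i => mul_nonneg ht (hv i),
    fun p => by simp only [Pi.smul_apply, h, smul_eq_mul]; ring⟩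

theorem rowVec_mem_portCone (i : Fin N) :
    (fun p : Fin N × Fin N => if p.1 = i then (1 : ℝ) else 0) ∈ portCone N :=
  ⟨fun k => if k = i then 1 else 0, 0, fun k => by dsimp only; split_ifs <;> simp, by simp,
    by simp⟩

theorem colVec_mem_portCone (j : Fin N) :
    (fun p : Fin N × Fin N => if p.2 = j then (1 : ℝ) else 0) ∈ portCone N :=
  ⟨0, fun k => if k = j then 1 else 0, by simp, fun k => by dsimp only; split_ifs <;> simp,
    by simp⟩

theorem dotProduct_rowVec (x : Fin N × Fin N → ℝ) (i : Fin N) :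
    (x ⬝ᵥ fun p => if p.1 = i then (1 : ℝ) else 0) = rowSum x i := by
  simp [dotProduct, Fintype.sum_prod_type_right, rowSum]

theorem dotProduct_colVec (x : Fin N × Fin N → ℝ) (j : Fin N) :
    (x ⬝ᵥ fun p => if p.2 = j then (1 : ℝ) else 0) = colSum x j := by
  simp [dotProduct, Fintype.sum_prod_type, colSum]

theorem dotProduct_eq_of_mem_portCone {y x x' : Fin N × Fin N → ℝ} (hy : y ∈ portCone N)
    (hr : ∀ i, rowSum x i = rowSum x' i) (hc : ∀ j, colSum x j = colSum x' j) :
    y ⬝ᵥ x = y ⬝ᵥ x' := by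
  obtain ⟨w, v, -, -, h⟩ := hy
  have key : ∀ x : Fin N × Fin N → ℝ,
      y ⬝ᵥ x = ∑ i, w i * rowSum x i + ∑ j, v j * colSum x j := by
    intro x
    simp only [dotProduct, h, add_mul, Finset.sum_add_distrib, rowSum, colSum, Finset.mul_sum]
    rw [Fintype.sum_prod_type, Fintype.sum_prod_type_right]
  rw [key, key]; simp only [hr, hc]

theorem sq_le_dotProduct_self (x : Fin N × Fin N → ℝ) (p : Fin N × Fin N) :
    x p ^ 2 ≤ x ⬝ᵥ x := by
  rw [pow_two]
  exact Finset.single_le_sum (f := fun p => x p * x p) (fun p _ => mul_self_nonneg _)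
    (Finset.mem_univ p)

theorem dotProduct_self_nonneg' (x : Fin N × Fin N → ℝ) : 0 ≤ x ⬝ᵥ x :=
  Finset.sum_nonneg fun _ _ => mul_self_nonneg _

theorem abs_le_sqrt_dotProduct_self (x : Fin N × Fin N → ℝ) (p : Fin N × Fin N) :
    |x p| ≤ √(x ⬝ᵥ x) :=
  Real.abs_le_sqrt (sq_le_dotProduct_self x p)

/-- A nonnegative vector has a closest point in the port cone. -/
theorem exists_closest_portCone {x : Fin N × Fin N → ℝ} (hx : ∀ p, 0 ≤ x p) :
    ∃ y ∈ portCone N, ∀ y' ∈ portCone N, (x - y) ⬝ᵥ (x - y) ≤ (x - y') ⬝ᵥ (x - y') := by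
  let Y : (Fin N → ℝ) × (Fin N → ℝ) → (Fin N × Fin N → ℝ) := fun v p => v.1 p.1 + v.2 p.2
  let f : (Fin N → ℝ) × (Fin N → ℝ) → ℝ := fun v => (x - Y v) ⬝ᵥ (x - Y v)
  have hf : Continuous f := by
    simp only [f, Y, dotProduct, Pi.sub_apply]; fun_prop
  set b : ℝ := total x + x ⬝ᵥ x + 1 with hb
  have hS : 0 ≤ x ⬝ᵥ x := dotProduct_self_nonneg' x
  have hT : 0 ≤ total x := Finset.sum_nonneg fun p _ => hx p
  have hxT : ∀ p, x p ≤ total x := fun p =>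
    Finset.single_le_sum (fun p _ => hx p) (Finset.mem_univ p)
  have hcpt : IsCompact (Set.Icc (0 : (Fin N → ℝ) × (Fin N → ℝ)) (fun _ => b, fun _ => b)) :=
    isCompact_Icc
  have h0mem : (0 : (Fin N → ℝ) × (Fin N → ℝ)) ∈
      Set.Icc (0 : (Fin N → ℝ) × (Fin N → ℝ)) (fun _ => b, fun _ => b) :=
    ⟨le_rfl, fun _ => by simp; linarith, fun _ => by simp; linarith⟩
  obtain ⟨v, hv, hmin⟩ := hcpt.exists_isMinOn ⟨_, h0mem⟩ hf.continuousOn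
  refine ⟨Y v, ⟨v.1, v.2, hv.1.1, hv.1.2, fun _ => rfl⟩, ?_⟩
  rintro y' ⟨w, w', hw, hw', h⟩
  have hy' : y' = Y (w, w') := funext h
  have hf0 : f 0 = x ⬝ᵥ x := by simp [f, Y, dotProduct]
  by_cases hmem : (w, w') ∈ Set.Icc (0 : (Fin N → ℝ) × (Fin N → ℝ)) (fun _ => b, fun _ => b)
  · rw [hy']; exact hmin hmem
  · have : ∃ p, b < y' p := by
      by_contra! hcon
      refine hmem ⟨⟨hw, hw'⟩, fun i => ?_, fun j => ?_⟩
      · have := hcon (i, i); rw [h] at this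
        have := hw' i
        dsimp only at *; linarith
      · have := hcon (j, j); rw [h] at this
        have := hw j
        dsimp only at *; linarith
    obtain ⟨p, hp⟩ := this
    have h1 : f v ≤ f 0 := hmin h0mem
    have h2 := sq_le_dotProduct_self (x - y') p
    have h3 : x ⬝ᵥ x ≤ ((x - y') p) ^ 2 := by
      have := hxT p
      simp only [Pi.sub_apply]
      nlinarith
    exact (h1.trans (hf0.le.trans h3)).trans h2

theorem dotProduct_le_zero_of_closest {x y h : Fin N × Fin N → ℝ}
    (hy : ∀ y' ∈ portCone N, (x - y) ⬝ᵥ (x - y) ≤ (x - y') ⬝ᵥ (x - y'))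
    (hh : ∀ t : ℝ, 0 < t → t ≤ 1 → y + t • h ∈ portCone N) : (x - y) ⬝ᵥ h ≤ 0 := by
  by_contra! hpos
  set a := (x - y) ⬝ᵥ h
  have hb : 0 ≤ h ⬝ᵥ h := dotProduct_self_nonneg' h
  have key : ∀ t : ℝ, 0 < t → t ≤ 1 → 2 * a ≤ t * (h ⬝ᵥ h) := by
    intro t ht ht1
    have := hy _ (hh t ht ht1)
    have e : x - (y + t • h) = (x - y) - t • h := by abel
    rw [e, sub_dotProduct _ (t • h), dotProduct_sub _ _ (t • h), dotProduct_sub _ _ (t • h), smul_dotProduct, dotProduct_smul,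
      smul_dotProduct, dotProduct_smul, dotProduct_comm h] at this
    simp only [smul_eq_mul] at this
    have : t * (2 * a) ≤ t * (t * (h ⬝ᵥ h)) := by linarith
    exact le_of_mul_le_mul_left this ht
  have ht : 0 < min 1 (a / (h ⬝ᵥ h + 1)) := lt_min one_pos (by positivity)
  have h1 := key _ ht (min_le_left _ _)
  have h2 : min 1 (a / (h ⬝ᵥ h + 1)) * (h ⬝ᵥ h) ≤ a / (h ⬝ᵥ h + 1) * (h ⬝ᵥ h + 1) :=
    mul_le_mul (min_le_right _ _) (by linarith) hb (by positivity)
  rw [div_mul_cancel₀ _ (by linarith)] at h2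
  linarith

/-- The closest point of the port cone to the queue lengths. -/
noncomputable def conePoint (q : QVec N) : Fin N × Fin N → ℝ :=
  (exists_closest_portCone (x := toReal q) (fun p => by simp)).choose

/-- The part of the queue lengths orthogonal to the port cone. -/
noncomputable def perp (q : QVec N) : Fin N × Fin N → ℝ := toReal q - conePoint q

theorem conePoint_mem (q : QVec N) : conePoint q ∈ portCone N :=
  (exists_closest_portCone (x := toReal q) (fun p => by simp)).choose_spec.1

theorem perp_min (q : QVec N) {y : Fin N × Fin N → ℝ} (hy : y ∈ portCone N) :
    perp q ⬝ᵥ perp q ≤ (toReal q - y) ⬝ᵥ (toReal q - y) :=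
  (exists_closest_portCone (x := toReal q) (fun p => by simp)).choose_spec.2 y hy

theorem rowSum_perp_le (q : QVec N) (i : Fin N) : rowSum (perp q) i ≤ 0 := by
  rw [← dotProduct_rowVec]
  exact dotProduct_le_zero_of_closest (fun _ h => perp_min q h) fun t ht _ =>
    add_mem_portCone (conePoint_mem q) (smul_mem_portCone (rowVec_mem_portCone i) ht.le)

theorem colSum_perp_le (q : QVec N) (j : Fin N) : colSum (perp q) j ≤ 0 := by
  rw [← dotProduct_colVec]
  exact dotProduct_le_zero_of_closest (fun _ h => perp_min q h) fun t ht _ =>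
    add_mem_portCone (conePoint_mem q) (smul_mem_portCone (colVec_mem_portCone j) ht.le)

theorem dotProduct_perp_conePoint_nonneg (q : QVec N) : 0 ≤ perp q ⬝ᵥ conePoint q := by
  have := dotProduct_le_zero_of_closest (h := -conePoint q) (fun _ h => perp_min q h)
    fun t ht ht1 => by
      have e : conePoint q + t • -conePoint q = (1 - t) • conePoint q := by
        rw [sub_smul, one_smul, smul_neg, sub_eq_add_neg]
      rw [e]; exact smul_mem_portCone (conePoint_mem q) (by linarith)
  rw [dotProduct_neg] at this
  simp only [perp]
  linarith

/-- The length of the part of the queue lengths orthogonal to the port cone. -/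
noncomputable def perpNorm (q : QVec N) : ℝ := √(perp q ⬝ᵥ perp q)

theorem perpNorm_nonneg (q : QVec N) : 0 ≤ perpNorm q := Real.sqrt_nonneg _

theorem perpNorm_sq (q : QVec N) : perpNorm q ^ 2 = perp q ⬝ᵥ perp q :=
  Real.sq_sqrt (dotProduct_self_nonneg' _)

theorem abs_perp_le (q : QVec N) (p : Fin N × Fin N) : |perp q p| ≤ perpNorm q :=
  abs_le_sqrt_dotProduct_self _ p

/-- MaxWeight schedules beat every positive saturated rate by a multiple of the distance to the
port cone. -/
theorem dotProduct_add_perpNorm_le {q s : QVec N} (hs : s ∈ maxWeightSchedules q)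
    {ν : Fin N × Fin N → ℝ} (hν : IsBistochastic ν) {δ : ℝ} (hδ : 0 < δ) (hδν : ∀ p, δ ≤ ν p) :
    toReal q ⬝ᵥ ν + δ * perpNorm q ≤ toReal q ⬝ᵥ toReal s := by
  rcases (perpNorm_nonneg q).eq_or_lt with h0 | hpos
  · rw [← h0, mul_zero, add_zero]; exact dotProduct_le_of_isBistochastic hs hν
  set n := perpNorm q
  have hx : IsSubstochastic (ν + (δ / n) • perp q) := by
    refine ⟨fun p => ?_, fun i => ?_, fun j => ?_⟩
    · have h1 := (abs_le.1 (abs_perp_le q p)).1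
      have h2 : (δ / n) * (-n) ≤ δ / n * perp q p :=
        mul_le_mul_of_nonneg_left h1 (by positivity)
      have h3 : (δ / n) * (-n) = -δ := by field_simp
      have := hδν p
      simp only [Pi.add_apply, Pi.smul_apply, smul_eq_mul]; linarith
    · have : rowSum (ν + (δ / n) • perp q) i = rowSum ν i + (δ / n) * rowSum (perp q) i := by
        simp [rowSum, Finset.sum_add_distrib, Finset.mul_sum]
      rw [this, hν.row_eq]
      have := mul_nonpos_of_nonneg_of_nonpos (show 0 ≤ δ / n by positivity) (rowSum_perp_le q i)
      linarith
    · have : colSum (ν + (δ / n) • perp q) j = colSum ν j + (δ / n) * colSum (perp q) j := by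
        simp [colSum, Finset.sum_add_distrib, Finset.mul_sum]
      rw [this, hν.col_eq]
      have := mul_nonpos_of_nonneg_of_nonpos (show 0 ≤ δ / n by positivity) (colSum_perp_le q j)
      linarith
  have h := dotProduct_le_of_isSubstochastic hs hx
  rw [dotProduct_add, dotProduct_smul, smul_eq_mul] at h
  have h2 : n ^ 2 ≤ toReal q ⬝ᵥ perp q := by
    have e : toReal q = perp q + conePoint q := by simp [perp]
    rw [e, add_dotProduct, perpNorm_sq, dotProduct_comm (conePoint q)]
    linarith [dotProduct_perp_conePoint_nonneg q]
  have h3 : δ / n * n ^ 2 ≤ δ / n * (toReal q ⬝ᵥ perp q) :=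
    mul_le_mul_of_nonneg_left h2 (by positivity)
  have h4 : δ / n * n ^ 2 = δ * n := by field_simp
  linarith

theorem dotProduct_perp_drift_le {q s : QVec N} (hs : s ∈ maxWeightSchedules q)
    {ν : Fin N × Fin N → ℝ} (hν : IsBistochastic ν) {δ : ℝ} (hδ : 0 < δ) (hδν : ∀ p, δ ≤ ν p)
    {ε : ℝ} (hε : 0 ≤ ε) :
    perp q ⬝ᵥ ((1 - ε) • ν - fill (toReal s)) ≤ -(δ - ε * N) * perpNorm q := by
  have hf := (isSubstochastic_of_mem_schedules hs.1).isBistochastic_fill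
  have h1 : conePoint q ⬝ᵥ ν = conePoint q ⬝ᵥ fill (toReal s) :=
    dotProduct_eq_of_mem_portCone (conePoint_mem q) (fun i => by rw [hν.row_eq, hf.row_eq])
      (fun i => by rw [hν.col_eq, hf.col_eq])
  have h2 := dotProduct_add_perpNorm_le hs hν hδ hδν
  have h3 := dotProduct_fill_eq hs
  have h4 : -(perp q ⬝ᵥ ν) ≤ N * perpNorm q := by
    rw [← hν.total_eq, total, Finset.sum_mul, dotProduct, ← Finset.sum_neg_distrib]
    refine Finset.sum_le_sum fun p _ => ?_
    have := (abs_le.1 (abs_perp_le q p)).1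
    nlinarith [hν.nonneg p]
  have h5 : ε * -(perp q ⬝ᵥ ν) ≤ ε * (N * perpNorm q) := mul_le_mul_of_nonneg_left h4 hε
  have e : perp q ⬝ᵥ (ν - fill (toReal s)) ≤ -(δ * perpNorm q) := by
    rw [perp, sub_dotProduct, dotProduct_sub, dotProduct_sub]; linarith
  have e2 : (1 - ε) • ν - fill (toReal s) = (ν - fill (toReal s)) - ε • ν := by
    rw [sub_smul, one_smul]; abel
  rw [e2, dotProduct_sub, dotProduct_smul, smul_eq_mul]
  linarith

theorem dotProduct_drift_le {q s : QVec N} (hs : s ∈ maxWeightSchedules q)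
    {ν : Fin N × Fin N → ℝ} (hν : IsBistochastic ν) {δ : ℝ} (hδ : 0 < δ) (hδν : ∀ p, δ ≤ ν p)
    {ε : ℝ} (hε : 0 ≤ ε) :
    toReal q ⬝ᵥ ((1 - ε) • ν - fill (toReal s)) ≤ -(ε * δ) * √(toReal q ⬝ᵥ toReal q) := by
  have h1 := dotProduct_le_of_isBistochastic hs hν
  have h3 := dotProduct_fill_eq hs
  have h4 : δ * √(toReal q ⬝ᵥ toReal q) ≤ toReal q ⬝ᵥ ν := by
    have hnn : ∀ p, 0 ≤ toReal q p := fun p => by simp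
    have hle : √(toReal q ⬝ᵥ toReal q) ≤ total (toReal q) := by
      have h0 : 0 ≤ total (toReal q) := Finset.sum_nonneg fun p _ => hnn p
      refine Real.sqrt_le_iff.2 ⟨h0, ?_⟩
      rw [pow_two, dotProduct]
      conv_rhs => rw [total, Finset.sum_mul]
      exact Finset.sum_le_sum fun p _ => mul_le_mul_of_nonneg_left
        (Finset.single_le_sum (fun p _ => hnn p) (Finset.mem_univ p)) (hnn p)
    refine (mul_le_mul_of_nonneg_left hle hδ.le).trans ?_
    rw [total, Finset.mul_sum, dotProduct]
    exact Finset.sum_le_sum fun p _ => by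
      rw [mul_comm]; exact mul_le_mul_of_nonneg_left (hδν p) (hnn p)
  have h5 := mul_le_mul_of_nonneg_left h4 hε
  rw [dotProduct_sub, dotProduct_smul, smul_eq_mul]
  linarith

/-- Bound on the growth of the squared distance to a point of the port cone. -/
theorem dist_sq_nextQueue_le {q a s : QVec N} {Amax : ℕ} (hs : s ∈ maxWeightSchedules q)
    (ha : ∀ p, a p ≤ Amax) {y : Fin N × Fin N → ℝ} (hy : y ∈ portCone N) :
    (toReal (nextQueue q a s) - y) ⬝ᵥ (toReal (nextQueue q a s) - y) ≤
      (toReal q - y) ⬝ᵥ (toReal q - y)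
        + (2 * ((toReal q - y) ⬝ᵥ (toReal a - fill (toReal s))) + N ^ 2 * (Amax + 1) ^ 2) := by
  set v := toReal (nextQueue q a s) - toReal q with hv
  have e1 : toReal (nextQueue q a s) - y = (toReal q - y) + v := by rw [hv]; abel
  have e2 : v = (toReal a - fill (toReal s)) + idle q a s := by rw [hv, idle]; abel
  have h1 : v ⬝ᵥ v ≤ N ^ 2 * (Amax + 1) ^ 2 := by
    have : ∀ p ∈ Finset.univ, v p * v p ≤ ((Amax : ℝ) + 1) ^ 2 := fun p _ => by
      rw [← pow_two]
      exact sq_le_sq' (abs_le.1 (abs_nextQueue_sub_le hs.1 ha p)).1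
        (abs_le.1 (abs_nextQueue_sub_le hs.1 ha p)).2
    refine (Finset.sum_le_sum this).trans (le_of_eq ?_)
    simp only [Finset.sum_const, Finset.card_univ, Fintype.card_prod, Fintype.card_fin,
      nsmul_eq_mul, Nat.cast_mul]
    ring
  have h2 : (toReal q - y) ⬝ᵥ idle q a s ≤ 0 := by
    refine Finset.sum_nonpos fun p _ => ?_
    have h1 := queue_mul_idle (a := a) hs p
    have h2 := mul_nonneg (nonneg_of_mem_portCone hy p) (idle_nonneg (q := q) (a := a) hs.1 p)
    simp only [Pi.sub_apply, toReal_apply, sub_mul]; linarith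
  have h3 : (toReal q - y) ⬝ᵥ v =
      (toReal q - y) ⬝ᵥ (toReal a - fill (toReal s)) + (toReal q - y) ⬝ᵥ idle q a s := by
    rw [e2, dotProduct_add]
  rw [e1, add_dotProduct, dotProduct_add, dotProduct_add, dotProduct_comm v (toReal q - y)]
  linarith

end

section


/-- The expectation of an extended nonnegative function. -/
noncomputable def expect {α : Type*} (p : PMF α) (f : α → ℝ≥0∞) : ℝ≥0∞ := ∑' x, p x * f x

section expect

variable {α β : Type*}

theorem lintegral_toMeasure_eq_expect [MeasurableSpace α] [Countable α]
    [MeasurableSingletonClass α] (p : PMF α) (f : α → ℝ≥0∞) :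
    ∫⁻ x, f x ∂p.toMeasure = expect p f := by
  rw [lintegral_countable']
  refine tsum_congr fun x => ?_
  rw [PMF.toMeasure_apply_singleton _ _ (measurableSet_singleton x), mul_comm]

theorem expect_bind (p : PMF α) (κ : α → PMF β) (f : β → ℝ≥0∞) :
    expect (p.bind κ) f = expect p fun x => expect (κ x) f := by
  simp only [expect, PMF.bind_apply, ← ENNReal.tsum_mul_right, ← ENNReal.tsum_mul_left]
  rw [ENNReal.tsum_comm]
  simp only [mul_assoc]

theorem expect_pure (x : α) (f : α → ℝ≥0∞) : expect (PMF.pure x) f = f x := by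
  rw [expect, tsum_eq_single x]
  · simp
  · intro y hy; simp [hy]

theorem expect_map (p : PMF α) (g : α → β) (f : β → ℝ≥0∞) :
    expect (p.map g) f = expect p fun x => f (g x) := by
  rw [PMF.map, expect_bind]; simp [expect_pure]

theorem expect_mono {p : PMF α} {f g : α → ℝ≥0∞} (h : ∀ x ∈ p.support, f x ≤ g x) :
    expect p f ≤ expect p g := by
  refine ENNReal.tsum_le_tsum fun x => ?_
  by_cases hx : x ∈ p.support
  · exact mul_le_mul_right (h x hx) _
  · rw [← PMF.apply_eq_zero_iff] at hx; simp [hx]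

theorem expect_const (p : PMF α) (c : ℝ≥0∞) : expect p (fun _ => c) = c := by
  simp [expect, ENNReal.tsum_mul_right]

theorem expect_add (p : PMF α) (f g : α → ℝ≥0∞) :
    expect p (fun x => f x + g x) = expect p f + expect p g := by
  simp only [expect, mul_add, ENNReal.tsum_add]

theorem expect_le_of_le {p : PMF α} {f : α → ℝ≥0∞} {c : ℝ≥0∞} (h : ∀ x, f x ≤ c) :
    expect p f ≤ c :=
  (expect_mono fun x _ => h x).trans (expect_const p c).le

theorem eq_of_forall_le {p q : PMF α} (h : ∀ x, p x ≤ q x) : p = q := by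
  by_contra hne
  obtain ⟨x, hx⟩ : ∃ x, p x ≠ q x := by
    by_contra! hcon; exact hne (PMF.ext hcon)
  have := ENNReal.tsum_lt_tsum (by rw [p.tsum_coe]; simp) h (lt_of_le_of_ne (h x) hx)
  rw [p.tsum_coe, q.tsum_coe] at this
  exact lt_irrefl _ this

end expect

section Markov

variable {S : Type*} {κ : S → PMF S} {V f : S → ℝ≥0∞} {C : ℝ≥0∞}

/-- Foster's moment bound for stationary laws: no moment of `V` is assumed to be finite. -/
theorem expect_le_of_drift {π : PMF S} (hπ : π.bind κ = π) (hV : ∀ x, V x ≠ ∞)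
    (hdrift : ∀ x, expect (κ x) V + f x ≤ V x + C) : expect π f ≤ C := by
  have htrunc : ∀ M : ℕ, expect π (fun x => if V x + C ≤ M then f x else 0) ≤ C := by
    intro M
    have h1 : expect π (fun x => min (V x) M) ≤ expect π (fun x => min (expect (κ x) V) M) := by
      conv_lhs => rw [← hπ, expect_bind]
      refine expect_mono fun x _ => le_min (expect_mono fun y _ => min_le_left _ _)
        (expect_le_of_le fun y => min_le_right _ _)
    have h2 : expect π (fun x => min (expect (κ x) V) M) +
        expect π (fun x => if V x + C ≤ M then f x else 0) ≤
        expect π (fun x => min (V x) M) + C := by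
      rw [← expect_add, ← expect_const π C, ← expect_add]
      refine expect_mono fun x _ => ?_
      rw [expect_const]
      split_ifs with h
      · have hVM : V x ≤ M := le_self_add.trans h
        rw [min_eq_left hVM]
        exact (add_le_add_left (min_le_left _ _) _).trans (hdrift x)
      · rw [add_zero]
        rcases le_total (V x) M with h' | h'
        · rw [min_eq_left h']; exact (min_le_right _ _).trans (not_le.1 h).le
        · rw [min_eq_right h']; exact (min_le_right _ _).trans le_self_add
    have hfin : expect π (fun x => min (expect (κ x) V) M) ≠ ∞ :=
      ne_top_of_le_ne_top (ENNReal.natCast_ne_top M) (expect_le_of_le fun x => min_le_right _ _)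
    exact (ENNReal.add_le_add_iff_left hfin).1 (h2.trans (add_le_add_left h1 _))
  by_cases hC : C = ∞
  · simp [hC]
  rw [expect, ENNReal.tsum_eq_iSup_sum]
  refine iSup_le fun F => ?_
  obtain ⟨M, hM⟩ : ∃ M : ℕ, ∀ x ∈ F, V x + C ≤ M := by
    have : ∑ x ∈ F, (V x + C) ≠ ∞ :=
      ENNReal.sum_ne_top.2 fun x _ => ENNReal.add_ne_top.2 ⟨hV x, hC⟩
    obtain ⟨M, hM⟩ := ENNReal.exists_nat_gt this
    exact ⟨M, fun x hx => (Finset.single_le_sum (f := fun x => V x + C)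
      (fun _ _ => zero_le) hx).trans hM.le⟩
  refine le_trans ?_ (htrunc M)
  refine le_trans (Finset.sum_le_sum fun x hx => ?_) (ENNReal.sum_le_tsum F)
  simp [hM x hx]

/-- The law of the chain after `k` steps. -/
noncomputable def lawAt (κ : S → PMF S) (x₀ : S) (k : ℕ) : PMF S :=
  (fun p : PMF S => p.bind κ)^[k] (PMF.pure x₀)

theorem lawAt_succ (κ : S → PMF S) (x₀ : S) (k : ℕ) :
    lawAt κ x₀ (k + 1) = (lawAt κ x₀ k).bind κ :=
  Function.iterate_succ_apply' _ _ _

/-- The occupation average of the first `n + 1` steps. -/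
noncomputable def cesaro (κ : S → PMF S) (x₀ : S) (n : ℕ) (x : S) : ℝ≥0∞ :=
  ((n : ℝ≥0∞) + 1)⁻¹ * ∑ k ∈ Finset.range (n + 1), lawAt κ x₀ k x

theorem tsum_cesaro_mul (κ : S → PMF S) (x₀ : S) (n : ℕ) (g : S → ℝ≥0∞) :
    ∑' x, cesaro κ x₀ n x * g x =
      ((n : ℝ≥0∞) + 1)⁻¹ * ∑ k ∈ Finset.range (n + 1), expect (lawAt κ x₀ k) g := by
  simp only [cesaro, expect, mul_assoc, Finset.sum_mul, ENNReal.tsum_mul_left]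
  rw [Summable.tsum_finsetSum fun _ _ => ENNReal.summable]

theorem inv_succ_mul_cancel (n : ℕ) (c : ℝ≥0∞) :
    ((n : ℝ≥0∞) + 1)⁻¹ * (((n : ℝ≥0∞) + 1) * c) = c := by
  rw [← mul_assoc, ENNReal.inv_mul_cancel (by simp) (by simp), one_mul]

theorem tsum_cesaro (κ : S → PMF S) (x₀ : S) (n : ℕ) : ∑' x, cesaro κ x₀ n x = 1 := by
  have := tsum_cesaro_mul κ x₀ n fun _ => 1
  simp only [mul_one, expect_const, Finset.sum_const, Finset.card_range, nsmul_eq_mul] at this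
  rw [this, Nat.cast_add, Nat.cast_one, ENNReal.inv_mul_cancel (by simp) (by simp)]

theorem tsum_cesaro_mul_le (hdrift : ∀ x, expect (κ x) V + f x ≤ V x + C) (x₀ : S) (n : ℕ) :
    ∑' x, cesaro κ x₀ n x * f x ≤ V x₀ + C := by
  have hind : ∀ n : ℕ, expect (lawAt κ x₀ n) V +
      ∑ k ∈ Finset.range n, expect (lawAt κ x₀ k) f ≤ V x₀ + n * C := by
    intro n
    induction n with
    | zero => simp [lawAt, expect_pure]
    | succ n ih =>
      have h : expect (lawAt κ x₀ (n + 1)) V + expect (lawAt κ x₀ n) f ≤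
          expect (lawAt κ x₀ n) V + C := by
        rw [lawAt_succ, expect_bind, ← expect_add, ← expect_const (lawAt κ x₀ n) C, ← expect_add]
        exact expect_mono fun x _ => hdrift x
      rw [Finset.sum_range_succ]
      calc expect (lawAt κ x₀ (n + 1)) V + (∑ k ∈ Finset.range n, expect (lawAt κ x₀ k) f
              + expect (lawAt κ x₀ n) f)
          = (expect (lawAt κ x₀ (n + 1)) V + expect (lawAt κ x₀ n) f)
              + ∑ k ∈ Finset.range n, expect (lawAt κ x₀ k) f := by ring
        _ ≤ (expect (lawAt κ x₀ n) V + C)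
              + ∑ k ∈ Finset.range n, expect (lawAt κ x₀ k) f := by gcongr
        _ = (expect (lawAt κ x₀ n) V
              + ∑ k ∈ Finset.range n, expect (lawAt κ x₀ k) f) + C := by ring
        _ ≤ (V x₀ + n * C) + C := by gcongr
        _ = V x₀ + ((n + 1 : ℕ) : ℝ≥0∞) * C := by push_cast; ring
  rw [tsum_cesaro_mul]
  calc ((n : ℝ≥0∞) + 1)⁻¹ * ∑ k ∈ Finset.range (n + 1), expect (lawAt κ x₀ k) f
      ≤ ((n : ℝ≥0∞) + 1)⁻¹ * (((n : ℝ≥0∞) + 1) * (V x₀ + C)) := by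
        gcongr
        refine (le_add_self.trans (hind (n + 1))).trans ?_
        push_cast
        rw [mul_add]
        gcongr
        exact le_mul_of_one_le_left zero_le (by simp)
    _ = V x₀ + C := inv_succ_mul_cancel _ _

theorem tsum_cesaro_mul_kernel_le (κ : S → PMF S) (x₀ : S) (n : ℕ) (y : S) :
    ∑' x, cesaro κ x₀ n x * κ x y ≤ cesaro κ x₀ n y + ((n : ℝ≥0∞) + 1)⁻¹ := by
  rw [tsum_cesaro_mul]
  have : ∀ k, expect (lawAt κ x₀ k) (fun x => κ x y) = lawAt κ x₀ (k + 1) y := fun k => by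
    rw [lawAt_succ, PMF.bind_apply, expect]
  simp only [this]
  have h2 : ∑ k ∈ Finset.range (n + 1), lawAt κ x₀ (k + 1) y ≤
      (∑ k ∈ Finset.range (n + 1), lawAt κ x₀ k y) + 1 := by
    have := Finset.sum_range_succ' (fun k => lawAt κ x₀ k y) (n + 1)
    calc ∑ k ∈ Finset.range (n + 1), lawAt κ x₀ (k + 1) y
        ≤ ∑ k ∈ Finset.range (n + 1), lawAt κ x₀ (k + 1) y + lawAt κ x₀ 0 y := le_self_add
      _ = ∑ k ∈ Finset.range (n + 1), lawAt κ x₀ k y + lawAt κ x₀ (n + 1) y := by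
        rw [← this, Finset.sum_range_succ]
      _ ≤ _ := by gcongr; exact PMF.coe_le_one _ _
  calc _ ≤ ((n : ℝ≥0∞) + 1)⁻¹ * ((∑ k ∈ Finset.range (n + 1), lawAt κ x₀ k y) + 1) := by gcongr
    _ = _ := by rw [mul_add, mul_one, cesaro]

/-- A chain with a drift condition whose cost has finite sublevel sets has a stationary law. -/
theorem exists_stationary_of_drift (x₀ : S) (hV : V x₀ ≠ ∞) (hC : C ≠ ∞)
    (hf : ∀ M : ℕ, {x | f x < M}.Finite)
    (hdrift : ∀ x, expect (κ x) V + f x ≤ V x + C) : ∃ π : PMF S, π.bind κ = π := by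
  classical
  let U : Ultrafilter ℕ := hyperfilter ℕ
  have hU : (U : Filter ℕ) ≤ atTop := Nat.hyperfilter_le_atTop
  let π : S → ℝ≥0∞ := fun x => (U.map fun n => cesaro κ x₀ n x).lim
  have hlim : ∀ x, Tendsto (fun n => cesaro κ x₀ n x) U (𝓝 (π x)) := fun x =>
    Ultrafilter.le_nhds_lim (U.map fun n => cesaro κ x₀ n x)
  have hlimF : ∀ F : Finset S, Tendsto (fun n => ∑ x ∈ F, cesaro κ x₀ n x) U
      (𝓝 (∑ x ∈ F, π x)) := fun F => tendsto_finsetSum _ fun x _ => hlim x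
  have hle : ∑' x, π x ≤ 1 := by
    rw [ENNReal.tsum_eq_iSup_sum]
    refine iSup_le fun F => le_of_tendsto' (hlimF F) fun n => ?_
    exact (ENNReal.sum_le_tsum F).trans (tsum_cesaro κ x₀ n).le
  have hge : ∀ M : ℕ, (M : ℝ≥0∞) ≤ M * ∑' x, π x + (V x₀ + C) := by
    intro M
    set F := (hf M).toFinset
    have hn : ∀ n, (M : ℝ≥0∞) ≤ M * ∑ x ∈ F, cesaro κ x₀ n x + (V x₀ + C) := by
      intro n
      calc (M : ℝ≥0∞) = M * ∑' x, cesaro κ x₀ n x := by rw [tsum_cesaro, mul_one]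
        _ = ∑' x, M * cesaro κ x₀ n x := ENNReal.tsum_mul_left.symm
        _ ≤ ∑' x, (M * (if x ∈ F then cesaro κ x₀ n x else 0) + cesaro κ x₀ n x * f x) := by
          refine ENNReal.tsum_le_tsum fun x => ?_
          split_ifs with hx
          · exact le_self_add
          · rw [mul_zero, zero_add, mul_comm]
            gcongr
            simpa [F] using hx
        _ = M * ∑ x ∈ F, cesaro κ x₀ n x + ∑' x, cesaro κ x₀ n x * f x := by
          rw [ENNReal.tsum_add, ENNReal.tsum_mul_left]
          congr 2
          rw [tsum_eq_sum (s := F) fun x hx => by simp [hx]]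
          exact Finset.sum_congr rfl fun x hx => by simp [hx]
        _ ≤ _ := by gcongr; exact tsum_cesaro_mul_le hdrift x₀ n
    refine (ge_of_tendsto' ((ENNReal.Tendsto.const_mul (hlimF F)
      (Or.inr (ENNReal.natCast_ne_top M))).add_const (V x₀ + C)) hn).trans ?_
    gcongr
    exact ENNReal.sum_le_tsum F
  have hone : ∑' x, π x = 1 := by
    refine le_antisymm hle ?_
    by_contra! hlt
    have hpos : 1 - ∑' x, π x ≠ 0 := (tsub_pos_of_lt hlt).ne'
    have hB : V x₀ + C ≠ ∞ := ENNReal.add_ne_top.2 ⟨hV, hC⟩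
    obtain ⟨M, hM⟩ := ENNReal.exists_nat_gt (ENNReal.div_ne_top hB hpos)
    have hM' : V x₀ + C < M * (1 - ∑' x, π x) := by
      rwa [ENNReal.div_lt_iff (Or.inl hpos) (Or.inl (by simp))] at hM
    have hne : (M : ℝ≥0∞) * ∑' x, π x ≠ ∞ :=
      ENNReal.mul_ne_top (by simp) (ne_top_of_le_ne_top (by simp) hle)
    have : (M : ℝ≥0∞) * ∑' x, π x + (V x₀ + C) < M := by
      calc _ < M * ∑' x, π x + M * (1 - ∑' x, π x) := by
            exact ENNReal.add_lt_add_left hne hM'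
        _ = M := by rw [← mul_add, add_tsub_cancel_of_le hle, mul_one]
    exact absurd (hge M) (not_le.2 this)
  let P : PMF S := ⟨π, hone ▸ ENNReal.summable.hasSum⟩
  refine ⟨P, eq_of_forall_le fun y => ?_⟩
  rw [PMF.bind_apply, ENNReal.tsum_eq_iSup_sum]
  refine iSup_le fun F => ?_
  have h1 : Tendsto (fun n => ∑ x ∈ F, cesaro κ x₀ n x * κ x y) U
      (𝓝 (∑ x ∈ F, P x * κ x y)) := tendsto_finsetSum _ fun x _ =>
    ENNReal.Tendsto.mul_const (hlim x) (Or.inr (PMF.apply_ne_top _ _))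
  have h2 : Tendsto (fun n : ℕ => cesaro κ x₀ n y + ((n : ℝ≥0∞) + 1)⁻¹) U (𝓝 (P y + 0)) := by
    refine (hlim y).add (Tendsto.mono_left ?_ hU)
    have := (tendsto_add_atTop_iff_nat 1).2 ENNReal.tendsto_inv_nat_nhds_zero
    simpa using this
  rw [add_zero] at h2
  exact le_of_tendsto_of_tendsto' h1 h2 fun n =>
    (ENNReal.sum_le_tsum F).trans (tsum_cesaro_mul_kernel_le κ x₀ n y)

end Markov
end

section


theorem ae_mem_support {α : Type*} [MeasurableSpace α] [Countable α]
    [MeasurableSingletonClass α] (p : PMF α) : ∀ᵐ x ∂p.toMeasure, x ∈ p.support := by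
  rw [ae_iff, PMF.toMeasure_apply_eq_zero_iff _ (Set.to_countable _).measurableSet]
  exact Set.disjoint_left.2 fun x hx hx' => hx' hx

theorem integrable_of_bounded {α : Type*} [MeasurableSpace α] [DiscreteMeasurableSpace α]
    {μ : Measure α} [IsFiniteMeasure μ] {f : α → ℝ} (c : ℝ) (h : ∀ᵐ x ∂μ, |f x| ≤ c) :
    Integrable f μ :=
  Integrable.of_bound (Measurable.of_discrete.aestronglyMeasurable) c h

theorem exists_quartic_bound {c : ℝ} (hc : 0 < c) (b C : ℝ) :
    ∃ K : ℝ, 0 ≤ K ∧ ∀ n : ℝ, 0 ≤ n →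
      2 * n ^ 2 * (-c * n + C) + (b * (n + 1)) ^ 2 ≤ -n ^ 2 + K := by
  set m := 2 * |C| + 2 * b ^ 2 + 1 with hm
  have hm0 : 0 ≤ m := by positivity
  refine ⟨m * (m / (2 * c)) ^ 2 + 2 * b ^ 2, by positivity, fun n hn => ?_⟩
  have h1 : m * n ^ 2 ≤ 2 * c * n ^ 3 + m * (m / (2 * c)) ^ 2 := by
    rcases le_total n (m / (2 * c)) with h | h
    · have : m * n ^ 2 ≤ m * (m / (2 * c)) ^ 2 := by gcongr
      have : 0 ≤ 2 * c * n ^ 3 := by positivity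
      linarith
    · rw [div_le_iff₀ (by positivity)] at h
      have : m * n ^ 2 ≤ n * (2 * c) * n ^ 2 := by gcongr
      have : 0 ≤ m * (m / (2 * c)) ^ 2 := by positivity
      nlinarith
  have h2 : 2 * n ^ 2 * C ≤ 2 * n ^ 2 * |C| := by gcongr; exact le_abs_self C
  have h3 : (b * (n + 1)) ^ 2 ≤ 2 * b ^ 2 * n ^ 2 + 2 * b ^ 2 := by
    have := mul_nonneg (sq_nonneg b) (sq_nonneg (n - 1))
    nlinarith
  rw [hm] at h1
  nlinarith

variable {N : ℕ}

/-- If the square of `n` has bounded increments of size `n` and mean drift `-c n`, then its fourth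
power has drift `-n ^ 2`. -/
theorem expect_pow_four_le {A : PMF (QVec N)} {τ : QVec N → PMF (QVec N)} {n : QVec N → ℝ}
    {X : QVec N → QVec N → ℝ} {b c C K : ℝ} {q : QVec N} (hn : ∀ q, 0 ≤ n q)
    (hK : ∀ n : ℝ, 0 ≤ n → 2 * n ^ 2 * (-c * n + C) + (b * (n + 1)) ^ 2 ≤ -n ^ 2 + K)
    (hK0 : 0 ≤ K)
    (hstep : ∀ s ∈ (τ q).support, ∀ a ∈ A.support, n (nextQueue q a s) ^ 2 ≤ n q ^ 2 + X s a)
    (hX : ∀ s ∈ (τ q).support, ∀ a ∈ A.support, |X s a| ≤ b * (n q + 1))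
    (hmean : ∀ s ∈ (τ q).support, ∫ a, X s a ∂A.toMeasure ≤ -c * n q + C) :
    expect (step A τ q) (fun q' => ENNReal.ofReal (n q' ^ 4)) + ENNReal.ofReal (n q ^ 2) ≤
      ENNReal.ofReal (n q ^ 4) + ENNReal.ofReal K := by
  have key : ∀ s ∈ (τ q).support,
      expect (A.map fun a => nextQueue q a s) (fun q' => ENNReal.ofReal (n q' ^ 4))
        + ENNReal.ofReal (n q ^ 2) ≤ ENNReal.ofReal (n q ^ 4) + ENNReal.ofReal K := by
    intro s hs
    have hXi : Integrable (X s) A.toMeasure :=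
      integrable_of_bounded (b * (n q + 1)) ((ae_mem_support A).mono fun a ha => hX s hs a ha)
    set Y : QVec N → ℝ := fun a => 2 * n q ^ 2 * X s a + (n q ^ 4 + (b * (n q + 1)) ^ 2)
    have hYi : Integrable Y A.toMeasure := (hXi.const_mul _).add (integrable_const _)
    have hY : ∀ a ∈ A.support, n (nextQueue q a s) ^ 4 ≤ Y a := fun a ha => by
      have h1 := hstep s hs a ha
      have h2 : n (nextQueue q a s) ^ 4 ≤ (n q ^ 2 + X s a) ^ 2 := by
        calc n (nextQueue q a s) ^ 4 = (n (nextQueue q a s) ^ 2) ^ 2 := by ring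
          _ ≤ _ := by gcongr
      have h3 : X s a ^ 2 ≤ (b * (n q + 1)) ^ 2 :=
        sq_le_sq' (abs_le.1 (hX s hs a ha)).1 (abs_le.1 (hX s hs a ha)).2
      simp only [Y]
      nlinarith
    have hY0 : 0 ≤ᵐ[A.toMeasure] Y := (ae_mem_support A).mono fun a ha =>
      le_trans (pow_nonneg (hn _) 4) (hY a ha)
    have hint : ∫ a, Y a ∂A.toMeasure ≤ n q ^ 4 - n q ^ 2 + K := by
      simp only [Y]
      rw [integral_add (hXi.const_mul _) (integrable_const _), integral_const_mul]
      simp only [integral_const, probReal_univ, one_smul]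
      have h1 := mul_le_mul_of_nonneg_left (hmean s hs) (show 0 ≤ 2 * n q ^ 2 by positivity)
      have h2 := hK (n q) (hn q)
      linarith
    have h0 : 0 ≤ ∫ a, Y a ∂A.toMeasure := integral_nonneg_of_ae hY0
    calc expect (A.map fun a => nextQueue q a s) (fun q' => ENNReal.ofReal (n q' ^ 4))
          + ENNReal.ofReal (n q ^ 2)
        ≤ expect A (fun a => ENNReal.ofReal (Y a)) + ENNReal.ofReal (n q ^ 2) := by
          rw [expect_map]
          gcongr
          exact expect_mono fun a ha => ENNReal.ofReal_le_ofReal (hY a ha)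
      _ = ENNReal.ofReal (∫ a, Y a ∂A.toMeasure + n q ^ 2) := by
          rw [← lintegral_toMeasure_eq_expect, ← ofReal_integral_eq_lintegral_ofReal hYi hY0,
            ENNReal.ofReal_add h0 (sq_nonneg _)]
      _ ≤ ENNReal.ofReal (n q ^ 4 + K) := ENNReal.ofReal_le_ofReal (by linarith)
      _ = _ := ENNReal.ofReal_add (pow_nonneg (hn q) 4) hK0
  rw [step, expect_bind, ← expect_const (τ q) (ENNReal.ofReal (n q ^ 2)), ← expect_add]
  exact (expect_mono key).trans (expect_const _ _).le

variable {A : PMF (QVec N)} {τ : QVec N → PMF (QVec N)} {ν : Fin N × Fin N → ℝ} {Amax : ℕ}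
  {ε : ℝ}

theorem integrable_arrival (hbdd : ∀ a ∈ A.support, ∀ p, a p ≤ Amax) (p : Fin N × Fin N) :
    Integrable (fun a : QVec N => (a p : ℝ)) A.toMeasure :=
  integrable_of_bounded Amax ((ae_mem_support A).mono fun a ha => by
    rw [Nat.abs_cast]; exact_mod_cast hbdd a ha p)

theorem integral_dotProduct_arrival (hbdd : ∀ a ∈ A.support, ∀ p, a p ≤ Amax)
    (hmean : ∀ p, ∫ a, (a p : ℝ) ∂A.toMeasure = (1 - ε) * ν p) (z s : Fin N × Fin N → ℝ) :
    ∫ a, z ⬝ᵥ (toReal a - s) ∂A.toMeasure = z ⬝ᵥ ((1 - ε) • ν - s) := by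
  simp only [dotProduct, Pi.sub_apply, toReal_apply, Pi.smul_apply, smul_eq_mul]
  have hi : ∀ p, Integrable (fun a : QVec N => z p * ((a p : ℝ) - s p)) A.toMeasure := fun p =>
    ((integrable_arrival hbdd p).sub (integrable_const _)).const_mul _
  rw [integral_finsetSum _ fun p _ => hi p]
  refine Finset.sum_congr rfl fun p _ => ?_
  rw [integral_const_mul, integral_sub (integrable_arrival hbdd p) (integrable_const _), hmean]
  simp

theorem abs_dotProduct_arrival_sub_le {a s : QVec N} (hs : s ∈ schedules N)
    (ha : ∀ p, a p ≤ Amax) (z : Fin N × Fin N → ℝ) :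
    |z ⬝ᵥ (toReal a - fill (toReal s))| ≤ N ^ 2 * (Amax + 1) * √(z ⬝ᵥ z) := by
  have hf := (isSubstochastic_of_mem_schedules hs).isBistochastic_fill
  have : ∀ p ∈ Finset.univ, |z p * (toReal a - fill (toReal s)) p| ≤ (Amax + 1) * √(z ⬝ᵥ z) := by
    intro p _
    rw [abs_mul, mul_comm]
    have h1 : (a p : ℝ) ≤ Amax := by exact_mod_cast ha p
    have h2 := hf.le_one p
    have h3 := hf.nonneg p
    have h4 : (0 : ℝ) ≤ a p := by positivity
    refine mul_le_mul ?_ (abs_le_sqrt_dotProduct_self z p) (abs_nonneg _) (by positivity)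
    simp only [Pi.sub_apply, toReal_apply]
    rw [abs_le]; constructor <;> linarith
  refine (Finset.abs_sum_le_sum_abs _ _).trans ((Finset.sum_le_sum this).trans (le_of_eq ?_))
  simp only [Finset.sum_const, Finset.card_univ, Fintype.card_prod, Fintype.card_fin,
    nsmul_eq_mul, Nat.cast_mul]
  ring

/-- Drift of the fourth power of the distance to points of the port cone. -/
theorem exists_expect_pow_four_le (N Amax : ℕ) {c : ℝ} (hc : 0 < c) :
    ∃ K : ℝ, 0 ≤ K ∧ ∀ (A : PMF (QVec N)) (τ : QVec N → PMF (QVec N)) (ν : Fin N × Fin N → ℝ)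
      (ε : ℝ) (y : QVec N → Fin N × Fin N → ℝ),
      IsMaxWeightRule τ → (∀ a ∈ A.support, ∀ p, a p ≤ Amax) →
      (∀ p, ∫ a, (a p : ℝ) ∂A.toMeasure = (1 - ε) * ν p) →
      (∀ q, y q ∈ portCone N) →
      (∀ q q', (toReal q' - y q') ⬝ᵥ (toReal q' - y q') ≤ (toReal q' - y q) ⬝ᵥ (toReal q' - y q)) →
      (∀ q, ∀ s ∈ maxWeightSchedules q, (toReal q - y q) ⬝ᵥ ((1 - ε) • ν - fill (toReal s)) ≤
        -c * √((toReal q - y q) ⬝ᵥ (toReal q - y q))) →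
      ∀ q, expect (step A τ q) (fun q' =>
          ENNReal.ofReal (√((toReal q' - y q') ⬝ᵥ (toReal q' - y q')) ^ 4)) +
        ENNReal.ofReal (√((toReal q - y q) ⬝ᵥ (toReal q - y q)) ^ 2) ≤
        ENNReal.ofReal (√((toReal q - y q) ⬝ᵥ (toReal q - y q)) ^ 4) + ENNReal.ofReal K := by
  set B : ℝ := N ^ 2 * (Amax + 1) ^ 2 with hB
  have hB0 : 0 ≤ B := by positivity
  obtain ⟨K, hK0, hK⟩ := exists_quartic_bound (c := 2 * c) (by positivity)
    (2 * (N ^ 2 * (Amax + 1)) + B) B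
  refine ⟨K, hK0, fun A τ ν ε y hτ hbdd hmean hy hmin hdrift q => ?_⟩
  refine expect_pow_four_le (n := fun q => √((toReal q - y q) ⬝ᵥ (toReal q - y q)))
    (X := fun s a => 2 * ((toReal q - y q) ⬝ᵥ (toReal a - fill (toReal s))) + B)
    (fun q => Real.sqrt_nonneg _) hK hK0 (fun s hs a ha => ?_) (fun s hs a ha => ?_)
    (fun s hs => ?_)
  · simp only [Real.sq_sqrt (dotProduct_self_nonneg' _)]
    exact (hmin q _).trans (dist_sq_nextQueue_le (hτ q hs) (hbdd a ha) (hy q))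
  · have h := abs_dotProduct_arrival_sub_le (hτ q hs).1 (hbdd a ha) (toReal q - y q)
    set n := √((toReal q - y q) ⬝ᵥ (toReal q - y q))
    have hn : 0 ≤ n := Real.sqrt_nonneg _
    have h0 : 0 ≤ B * n := by positivity
    have h1 : (0 : ℝ) ≤ N ^ 2 * (Amax + 1) := by positivity
    rw [abs_le] at h ⊢
    constructor <;> linarith
  · have hi : Integrable (fun a => (toReal q - y q) ⬝ᵥ (toReal a - fill (toReal s)))
        A.toMeasure := by
      refine integrable_of_bounded _ ((ae_mem_support A).mono fun a ha =>
        abs_dotProduct_arrival_sub_le (hτ q hs).1 (hbdd a ha) (toReal q - y q))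
    rw [integral_add (hi.const_mul 2) (integrable_const _), integral_const_mul,
      integral_dotProduct_arrival hbdd hmean]
    simp only [integral_const, probReal_univ, one_smul]
    have := hdrift q s (hτ q hs)
    linarith

/-- Drift of the fourth power of the queue lengths, for a fixed load. -/
theorem exists_queue_drift (hτ : IsMaxWeightRule τ) (hbdd : ∀ a ∈ A.support, ∀ p, a p ≤ Amax)
    (hmean : ∀ p, ∫ a, (a p : ℝ) ∂A.toMeasure = (1 - ε) * ν p) (hν : IsBistochastic ν) {δ : ℝ}
    (hδ : 0 < δ) (hδν : ∀ p, δ ≤ ν p) (hε : 0 < ε) :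
    ∃ K : ℝ, 0 ≤ K ∧ ∀ q, expect (step A τ q) (fun q' =>
        ENNReal.ofReal (√(toReal q' ⬝ᵥ toReal q') ^ 4)) +
      ENNReal.ofReal (√(toReal q ⬝ᵥ toReal q) ^ 2) ≤
      ENNReal.ofReal (√(toReal q ⬝ᵥ toReal q) ^ 4) + ENNReal.ofReal K := by
  obtain ⟨K, hK0, hK⟩ := exists_expect_pow_four_le N Amax (mul_pos hε hδ)
  refine ⟨K, hK0, ?_⟩
  simpa only [sub_zero] using hK A τ ν ε (fun _ => 0) hτ hbdd hmean (fun _ => zero_mem_portCone)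
    (fun _ _ => le_rfl) fun q s hs => by
      simpa only [sub_zero] using dotProduct_drift_le hs hν hδ hδν hε.le

theorem exists_isSteadyState (hτ : IsMaxWeightRule τ) (hbdd : ∀ a ∈ A.support, ∀ p, a p ≤ Amax)
    (hmean : ∀ p, ∫ a, (a p : ℝ) ∂A.toMeasure = (1 - ε) * ν p) (hν : IsBistochastic ν) {δ : ℝ}
    (hδ : 0 < δ) (hδν : ∀ p, δ ≤ ν p) (hε : 0 < ε) : ∃ π, IsSteadyState A τ π := by
  obtain ⟨K, -, hK⟩ := exists_queue_drift hτ hbdd hmean hν hδ hδν hε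
  refine exists_stationary_of_drift 0 ENNReal.ofReal_ne_top ENNReal.ofReal_ne_top (fun M => ?_) hK
  refine (Set.finite_Iic (fun _ => M : QVec N)).subset fun q hq p => ?_
  have hq : ENNReal.ofReal (√(toReal q ⬝ᵥ toReal q) ^ 2) < M := hq
  rw [Real.sq_sqrt (dotProduct_self_nonneg' _), ← ENNReal.ofReal_natCast M,
    ENNReal.ofReal_lt_ofReal_iff_of_nonneg (dotProduct_self_nonneg' _)] at hq
  have h := (sq_le_dotProduct_self (toReal q) p).trans hq.le
  rw [toReal_apply] at h
  have h' : q p ^ 2 ≤ M := by exact_mod_cast h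
  exact (Nat.le_self_pow two_ne_zero _).trans h'

/-- The squared queue lengths have finite mean in steady state. -/
theorem integrable_dotProduct_self (hτ : IsMaxWeightRule τ)
    (hbdd : ∀ a ∈ A.support, ∀ p, a p ≤ Amax)
    (hmean : ∀ p, ∫ a, (a p : ℝ) ∂A.toMeasure = (1 - ε) * ν p) (hν : IsBistochastic ν) {δ : ℝ}
    (hδ : 0 < δ) (hδν : ∀ p, δ ≤ ν p) (hε : 0 < ε) {π : PMF (QVec N)}
    (hπ : IsSteadyState A τ π) : Integrable (fun q => toReal q ⬝ᵥ toReal q) π.toMeasure := by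
  obtain ⟨K, -, hK⟩ := exists_queue_drift hτ hbdd hmean hν hδ hδν hε
  have := expect_le_of_drift hπ (fun _ => ENNReal.ofReal_ne_top) hK
  rw [← lintegral_toMeasure_eq_expect] at this
  simp only [Real.sq_sqrt (dotProduct_self_nonneg' _)] at this
  exact (lintegral_ofReal_ne_top_iff_integrable Measurable.of_discrete.aestronglyMeasurable
    (Eventually.of_forall fun q => dotProduct_self_nonneg' _)).1
    (ne_top_of_le_ne_top ENNReal.ofReal_ne_top this)

/-- State space collapse: the part of the queue lengths orthogonal to the port cone has a second
moment in steady state that is bounded uniformly in heavy traffic. -/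
theorem exists_integral_perpNorm_sq_le (N Amax : ℕ) {δ : ℝ} (hδ : 0 < δ) :
    ∃ K : ℝ, 0 ≤ K ∧ ∀ (A : PMF (QVec N)) (τ : QVec N → PMF (QVec N)) (ν : Fin N × Fin N → ℝ)
      (ε : ℝ) (π : PMF (QVec N)), IsMaxWeightRule τ → (∀ a ∈ A.support, ∀ p, a p ≤ Amax) →
      (∀ p, ∫ a, (a p : ℝ) ∂A.toMeasure = (1 - ε) * ν p) → IsBistochastic ν →
      (∀ p, δ ≤ ν p) → 0 ≤ ε → ε * N ≤ δ / 2 → IsSteadyState A τ π →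
      Integrable (fun q => perpNorm q ^ 2) π.toMeasure ∧
        ∫ q, perpNorm q ^ 2 ∂π.toMeasure ≤ K := by
  obtain ⟨K, hK0, hK⟩ := exists_expect_pow_four_le N Amax (half_pos hδ)
  refine ⟨K, hK0, fun A τ ν ε π hτ hbdd hmean hν hδν hε hεN hπ => ?_⟩
  have h := hK A τ ν ε conePoint hτ hbdd hmean conePoint_mem
    (fun q q' => perp_min q' (conePoint_mem q)) fun q s hs => by
      refine (dotProduct_perp_drift_le hs hν hδ hδν hε).trans ?_
      exact mul_le_mul_of_nonneg_right (by linarith) (perpNorm_nonneg q)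
  have := expect_le_of_drift hπ (fun _ => ENNReal.ofReal_ne_top) h
  rw [← lintegral_toMeasure_eq_expect] at this
  have hlt : ∫⁻ q, ENNReal.ofReal (perpNorm q ^ 2) ∂π.toMeasure ≤ ENNReal.ofReal K := this
  have hnn : 0 ≤ᵐ[π.toMeasure] fun q => perpNorm q ^ 2 :=
    Eventually.of_forall fun q => sq_nonneg _
  have hi : Integrable (fun q => perpNorm q ^ 2) π.toMeasure :=
    (lintegral_ofReal_ne_top_iff_integrable Measurable.of_discrete.aestronglyMeasurable hnn).1
      (ne_top_of_le_ne_top ENNReal.ofReal_ne_top hlt)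
  refine ⟨hi, ?_⟩
  rwa [← ofReal_integral_eq_lintegral_ofReal hi hnn, ENNReal.ofReal_le_ofReal_iff hK0] at hlt

end

section


variable {N : ℕ}

/-- The matrix of the orthogonal projection on the span of the port cone. -/
noncomputable def portMatrix (N : ℕ) : Matrix (Fin N × Fin N) (Fin N × Fin N) ℝ :=
  Matrix.of fun p r => (if p.1 = r.1 then (N : ℝ)⁻¹ else 0) + (if p.2 = r.2 then (N : ℝ)⁻¹ else 0)
    - ((N : ℝ) ^ 2)⁻¹

theorem portMatrix_comm (p r : Fin N × Fin N) : portMatrix N p r = portMatrix N r p := by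
  simp only [portMatrix, Matrix.of_apply, eq_comm]

theorem portMatrix_mulVec (x : Fin N × Fin N → ℝ) (p : Fin N × Fin N) :
    (portMatrix N *ᵥ x) p =
      (N : ℝ)⁻¹ * rowSum x p.1 + (N : ℝ)⁻¹ * colSum x p.2 - ((N : ℝ) ^ 2)⁻¹ * total x := by
  simp only [Matrix.mulVec, dotProduct, portMatrix, Matrix.of_apply, sub_mul, add_mul,
    Finset.sum_sub_distrib, Finset.sum_add_distrib, ← Finset.mul_sum, total]
  congr 2
  · simp [Fintype.sum_prod_type_right, rowSum, Finset.mul_sum]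
  · simp [Fintype.sum_prod_type, colSum, Finset.mul_sum]

/-- The bilinear form of the orthogonal projection on the span of the port cone. -/
noncomputable def portForm (x y : Fin N × Fin N → ℝ) : ℝ := x ⬝ᵥ (portMatrix N *ᵥ y)

theorem portForm_comm (x y : Fin N × Fin N → ℝ) : portForm x y = portForm y x := by
  have h : (portMatrix N)ᵀ = portMatrix N := Matrix.ext fun p r => portMatrix_comm r p
  rw [portForm, portForm, Matrix.dotProduct_mulVec, ← Matrix.mulVec_transpose, h,
    dotProduct_comm]

theorem portForm_add_left (x x' y : Fin N × Fin N → ℝ) :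
    portForm (x + x') y = portForm x y + portForm x' y := add_dotProduct _ _ _

theorem portForm_sub_left (x x' y : Fin N × Fin N → ℝ) :
    portForm (x - x') y = portForm x y - portForm x' y := sub_dotProduct _ _ _

theorem portForm_add_right (x y y' : Fin N × Fin N → ℝ) :
    portForm x (y + y') = portForm x y + portForm x y' := by
  rw [portForm, Matrix.mulVec_add, dotProduct_add]; rfl

theorem portForm_sub_right (x y y' : Fin N × Fin N → ℝ) :
    portForm x (y - y') = portForm x y - portForm x y' := by
  rw [portForm, Matrix.mulVec_sub, dotProduct_sub]; rfl

theorem portForm_eq_sum (x y : Fin N × Fin N → ℝ) :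
    portForm x y = ∑ p, ∑ r, portMatrix N p r * (x p * y r) := by
  simp only [portForm, Matrix.mulVec, dotProduct, Finset.mul_sum]
  exact Finset.sum_congr rfl fun p _ => Finset.sum_congr rfl fun r _ => by ring

theorem portForm_of_isBistochastic (hN : 1 ≤ N) (x : Fin N × Fin N → ℝ) {y : Fin N × Fin N → ℝ}
    (hy : IsBistochastic y) : portForm x y = (N : ℝ)⁻¹ * total x := by
  have hN' : (N : ℝ) ≠ 0 := by positivity
  rw [portForm, total, Finset.mul_sum, dotProduct]
  refine Finset.sum_congr rfl fun p _ => ?_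
  rw [portMatrix_mulVec, hy.row_eq, hy.col_eq, hy.total_eq]
  field_simp
  ring

theorem rowSum_portMatrix_mulVec (hN : 1 ≤ N) (x : Fin N × Fin N → ℝ) (i : Fin N) :
    rowSum (portMatrix N *ᵥ x) i = rowSum x i := by
  have hN' : (N : ℝ) ≠ 0 := by positivity
  rw [rowSum]
  simp only [portMatrix_mulVec, Finset.sum_sub_distrib, Finset.sum_add_distrib, ← Finset.mul_sum,
    sum_colSum, Finset.sum_const, Finset.card_univ, Fintype.card_fin, nsmul_eq_mul]
  field_simp
  ring

theorem colSum_portMatrix_mulVec (hN : 1 ≤ N) (x : Fin N × Fin N → ℝ) (j : Fin N) :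
    colSum (portMatrix N *ᵥ x) j = colSum x j := by
  have hN' : (N : ℝ) ≠ 0 := by positivity
  rw [colSum]
  simp only [portMatrix_mulVec, Finset.sum_sub_distrib, Finset.sum_add_distrib, ← Finset.mul_sum,
    sum_rowSum, Finset.sum_const, Finset.card_univ, Fintype.card_fin, nsmul_eq_mul]
  field_simp
  ring

theorem portForm_of_mem_portCone (hN : 1 ≤ N) {y : Fin N × Fin N → ℝ} (hy : y ∈ portCone N)
    (x : Fin N × Fin N → ℝ) : portForm y x = y ⬝ᵥ x :=
  dotProduct_eq_of_mem_portCone hy (rowSum_portMatrix_mulVec hN x) (colSum_portMatrix_mulVec hN x)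

theorem sum_abs_portMatrix_mulVec_le (hN : 1 ≤ N) {x : Fin N × Fin N → ℝ} (hx : ∀ p, 0 ≤ x p) :
    ∑ p, |(portMatrix N *ᵥ x) p| ≤ 3 * total x := by
  have hN' : (N : ℝ) ≠ 0 := by positivity
  have hr : ∀ i, 0 ≤ rowSum x i := fun i => Finset.sum_nonneg fun _ _ => hx _
  have hc : ∀ i, 0 ≤ colSum x i := fun i => Finset.sum_nonneg fun _ _ => hx _
  have ht : 0 ≤ total x := Finset.sum_nonneg fun _ _ => hx _
  have hle : ∀ p ∈ Finset.univ, |(portMatrix N *ᵥ x) p| ≤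
      (N : ℝ)⁻¹ * rowSum x p.1 + (N : ℝ)⁻¹ * colSum x p.2 + ((N : ℝ) ^ 2)⁻¹ * total x := by
    intro p _
    rw [portMatrix_mulVec]
    have h1 : 0 ≤ (N : ℝ)⁻¹ * rowSum x p.1 := mul_nonneg (by positivity) (hr _)
    have h2 : 0 ≤ (N : ℝ)⁻¹ * colSum x p.2 := mul_nonneg (by positivity) (hc _)
    have h3 : 0 ≤ ((N : ℝ) ^ 2)⁻¹ * total x := mul_nonneg (by positivity) ht
    rw [abs_le]; constructor <;> linarith
  refine (Finset.sum_le_sum hle).trans (le_of_eq ?_)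
  simp only [Finset.sum_add_distrib, ← Finset.mul_sum]
  have e1 : ∑ p : Fin N × Fin N, rowSum x p.1 = N * total x := by
    rw [Fintype.sum_prod_type_right]; simp [sum_rowSum]
  have e2 : ∑ p : Fin N × Fin N, colSum x p.2 = N * total x := by
    rw [Fintype.sum_prod_type]; simp [sum_colSum]
  rw [e1, e2]
  simp only [Finset.sum_const, Finset.card_univ, Fintype.card_prod, Fintype.card_fin,
    nsmul_eq_mul, Nat.cast_mul]
  field_simp
  ring

theorem abs_portForm_le (hN : 1 ≤ N) {x u : Fin N × Fin N → ℝ} (hu : ∀ p, 0 ≤ u p) {n : ℝ}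
    (hx : ∀ p, |x p| ≤ n) (hn : 0 ≤ n) : |portForm x u| ≤ 3 * n * total u := by
  calc |portForm x u| ≤ ∑ p, |x p * (portMatrix N *ᵥ u) p| := Finset.abs_sum_le_sum_abs _ _
    _ ≤ ∑ p, n * |(portMatrix N *ᵥ u) p| := Finset.sum_le_sum fun p _ => by
        rw [abs_mul]; exact mul_le_mul_of_nonneg_right (hx p) (abs_nonneg _)
    _ ≤ n * (3 * total u) := by
        rw [← Finset.mul_sum]
        exact mul_le_mul_of_nonneg_left (sum_abs_portMatrix_mulVec_le hN hu) hn
    _ = _ := by ring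

/-- The contribution of idle service to the change of the quadratic form in a time slot. -/
noncomputable def idleTerm (q a s : QVec N) : ℝ :=
  portForm (toReal (nextQueue q a s)) (toReal (nextQueue q a s)) - portForm (toReal q) (toReal q)
    - 2 * portForm (toReal q) (toReal a - fill (toReal s))
    - portForm (toReal a - fill (toReal s)) (toReal a - fill (toReal s))

theorem idleTerm_eq (q a s : QVec N) :
    idleTerm q a s = 2 * portForm (toReal (nextQueue q a s)) (idle q a s)
      - portForm (idle q a s) (idle q a s) := by
  have e : toReal (nextQueue q a s) = toReal q + (toReal a - fill (toReal s)) + idle q a s := by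
    rw [idle]; abel
  rw [idleTerm, e]
  simp only [portForm_add_left, portForm_add_right]
  rw [portForm_comm (idle q a s) (toReal q),
    portForm_comm (idle q a s) (toReal a - fill (toReal s)),
    portForm_comm (toReal a - fill (toReal s)) (toReal q)]
  ring

theorem abs_idleTerm_le (hN : 1 ≤ N) {q a s : QVec N} {Amax : ℕ} (hs : s ∈ maxWeightSchedules q)
    (ha : ∀ p, a p ≤ Amax) :
    |idleTerm q a s| ≤ (2 * Amax + 3 + 8 * perpNorm (nextQueue q a s)) * total (idle q a s) := by
  set q' := nextQueue q a s with hq'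
  set u := idle q a s with hu
  have hu0 : ∀ p, 0 ≤ u p := idle_nonneg hs.1
  have h1 : |portForm u u| ≤ 3 * 1 * total u := abs_portForm_le hN hu0
    (fun p => by rw [abs_of_nonneg (hu0 p)]; exact idle_le_one hs.1 p) zero_le_one
  have h2 : |portForm (perp q') u| ≤ 3 * perpNorm q' * total u :=
    abs_portForm_le hN hu0 (abs_perp_le q') (perpNorm_nonneg q')
  have h3 : |perp q' ⬝ᵥ u| ≤ perpNorm q' * total u := by
    rw [total, Finset.mul_sum]
    refine (Finset.abs_sum_le_sum_abs _ _).trans (Finset.sum_le_sum fun p _ => ?_)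
    rw [abs_mul, abs_of_nonneg (hu0 p)]
    exact mul_le_mul_of_nonneg_right (abs_perp_le q' p) (hu0 p)
  have h4 : toReal q' ⬝ᵥ u ≤ Amax * total u := by
    rw [total, Finset.mul_sum]
    exact Finset.sum_le_sum fun p _ => nextQueue_mul_idle_le hs ha p
  have h5 : 0 ≤ toReal q' ⬝ᵥ u := Finset.sum_nonneg fun p _ => mul_nonneg (by simp) (hu0 p)
  have e : portForm (toReal q') u = portForm (perp q') u + toReal q' ⬝ᵥ u - perp q' ⬝ᵥ u := by
    have e1 : toReal q' = perp q' + conePoint q' := by simp [perp]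
    conv_lhs => rw [e1]
    conv_rhs => rw [e1]
    rw [portForm_add_left, portForm_of_mem_portCone hN (conePoint_mem q'), add_dotProduct]
    simp only [perp]
    ring_nf
  rw [idleTerm_eq, e]
  rw [abs_le] at *
  constructor <;> linarith [h1.1, h1.2, h2.1, h2.2, h3.1, h3.2]

theorem total_idle (q a s : QVec N) (hs : s ∈ schedules N) :
    total (idle q a s) =
      total (toReal (nextQueue q a s)) - total (toReal q) - total (toReal a) + N := by
  rw [← (isSubstochastic_of_mem_schedules hs).isBistochastic_fill.total_eq]
  simp only [total, idle, Pi.add_apply, Pi.sub_apply, Finset.sum_add_distrib,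
    Finset.sum_sub_distrib]

theorem sum_portMatrix_mul (hN : 1 ≤ N) (Sig : Matrix (Fin N × Fin N) (Fin N × Fin N) ℝ) :
    (N : ℝ) / 2 * ∑ p, ∑ r, portMatrix N p r * Sig p r =
      1 / (2 * (N : ℝ)) * ∑ p, ((2 * (N : ℝ) - 1) * Sig p p
            + ((N : ℝ) - 1) * ∑ r ∈ row p ∪ col p, Sig p r - ∑ r ∈ other p, Sig p r) := by
  have hN' : (N : ℝ) ≠ 0 := by positivity
  rw [Finset.mul_sum, Finset.mul_sum]
  refine Finset.sum_congr rfl fun p _ => ?_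
  have h1 : ∑ r, portMatrix N p r * Sig p r =
      ∑ r ∈ other p, portMatrix N p r * Sig p r +
        (∑ r ∈ row p ∪ col p, portMatrix N p r * Sig p r + portMatrix N p p * Sig p p) := by
    rw [← Finset.sum_sdiff (Finset.subset_univ (row p ∪ col p ∪ {p})), ← other,
      Finset.sum_union (by simp [row, col]), Finset.sum_singleton]
  have h2 : ∑ r ∈ other p, portMatrix N p r * Sig p r =
      -((N : ℝ) ^ 2)⁻¹ * ∑ r ∈ other p, Sig p r := by
    rw [Finset.mul_sum]
    refine Finset.sum_congr rfl fun r hr => ?_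
    simp only [other, row, col, Finset.mem_sdiff, Finset.mem_univ, Finset.mem_union,
      Finset.mem_filter, Finset.mem_singleton, true_and] at hr
    have h1 : p.1 ≠ r.1 := fun h => hr (by tauto)
    have h2 : p.2 ≠ r.2 := fun h => hr (by tauto)
    simp [portMatrix, h1, h2]
  have h3 : ∑ r ∈ row p ∪ col p, portMatrix N p r * Sig p r =
      ((N : ℝ)⁻¹ - ((N : ℝ) ^ 2)⁻¹) * ∑ r ∈ row p ∪ col p, Sig p r := by
    rw [Finset.mul_sum]
    refine Finset.sum_congr rfl fun r hr => ?_
    simp only [row, col, Finset.mem_sdiff, Finset.mem_univ, Finset.mem_union,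
      Finset.mem_filter, Finset.mem_singleton, true_and] at hr
    by_cases h1 : p.1 = r.1
    · have h2 : p.2 ≠ r.2 := fun h => by
        have : r = p := Prod.ext h1.symm h.symm
        tauto
      simp [portMatrix, h1, h2]
    · have h2 : p.2 = r.2 := by
        rcases hr with hr | hr
        · exact absurd hr.1.symm h1
        · exact hr.1.symm
      simp [portMatrix, h1, h2]
  have h4 : portMatrix N p p = 2 * (N : ℝ)⁻¹ - ((N : ℝ) ^ 2)⁻¹ := by
    simp [portMatrix]; ring
  rw [h1, h2, h3, h4]
  field_simp
  ring

end

section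


variable {N : ℕ}

/-- An integrable function together with the value of its integral. -/
structure HasMean {Ω : Type*} [MeasurableSpace Ω] (μ : Measure Ω) (f : Ω → ℝ) (m : ℝ) : Prop where
  integrable : Integrable f μ
  integral_eq : ∫ ω, f ω ∂μ = m

namespace HasMean

variable {Ω : Type*} [MeasurableSpace Ω] {μ : Measure Ω} {f g : Ω → ℝ} {m n : ℝ}

theorem add (hf : HasMean μ f m) (hg : HasMean μ g n) : HasMean μ (fun ω => f ω + g ω) (m + n) :=
  ⟨hf.1.add hg.1, by rw [integral_add hf.1 hg.1, hf.2, hg.2]⟩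

theorem sub (hf : HasMean μ f m) (hg : HasMean μ g n) : HasMean μ (fun ω => f ω - g ω) (m - n) :=
  ⟨hf.1.sub hg.1, by rw [integral_sub hf.1 hg.1, hf.2, hg.2]⟩

theorem const_mul (hf : HasMean μ f m) (c : ℝ) : HasMean μ (fun ω => c * f ω) (c * m) :=
  ⟨hf.1.const_mul c, by rw [integral_const_mul, hf.2]⟩

theorem const [IsProbabilityMeasure μ] (c : ℝ) : HasMean μ (fun _ => c) c :=
  ⟨integrable_const _, by simp⟩

theorem sum {ι : Type*} [Fintype ι] {f : ι → Ω → ℝ} {m : ι → ℝ}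
    (hf : ∀ i, HasMean μ (f i) (m i)) : HasMean μ (fun ω => ∑ i, f i ω) (∑ i, m i) :=
  ⟨integrable_finsetSum _ fun i _ => (hf i).1, by
    rw [integral_finsetSum _ fun i _ => (hf i).1]
    exact Finset.sum_congr rfl fun i _ => (hf i).2⟩

theorem comp {Ω' : Type*} [MeasurableSpace Ω'] [DiscreteMeasurableSpace Ω'] {ν : Measure Ω'}
    {T : Ω → Ω'} (hT : MeasurePreserving T μ ν) {g : Ω' → ℝ} (hg : Integrable g ν) :
    HasMean μ (fun ω => g (T ω)) (∫ x, g x ∂ν) :=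
  ⟨hT.integrable_comp_of_integrable hg, by
    rw [← hT.map_eq, integral_map hT.measurable.aemeasurable
      Measurable.of_discrete.aestronglyMeasurable]⟩

end HasMean

/-- The joint law of queue lengths and schedule when the queue lengths have law `π`. -/
noncomputable def scheduleLaw (τ : QVec N → PMF (QVec N)) (π : PMF (QVec N)) :
    PMF (QVec N × QVec N) :=
  π.bind fun q => (τ q).map fun s => (q, s)

/-- The joint law of queue lengths, schedule and arrivals in a time slot. -/
noncomputable def slotLaw (A : PMF (QVec N)) (τ : QVec N → PMF (QVec N)) (π : PMF (QVec N)) :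
    Measure ((QVec N × QVec N) × QVec N) :=
  (scheduleLaw τ π).toMeasure.prod A.toMeasure

variable {A : PMF (QVec N)} {τ : QVec N → PMF (QVec N)} {π : PMF (QVec N)}

instance : IsProbabilityMeasure (slotLaw A τ π) := by
  unfold slotLaw; infer_instance

theorem measurePreserving_queue :
    MeasurePreserving (fun ω : (QVec N × QVec N) × QVec N => ω.1.1) (slotLaw A τ π)
      π.toMeasure := by
  refine ⟨Measurable.of_discrete, Measure.ext_of_lintegral _ fun g _ => ?_⟩
  rw [lintegral_map Measurable.of_discrete Measurable.of_discrete, slotLaw,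
    lintegral_prod _ Measurable.of_discrete.aemeasurable]
  simp only [lintegral_toMeasure_eq_expect, scheduleLaw, expect_bind, expect_map, expect_const]

theorem measurePreserving_nextQueue (hπ : IsSteadyState A τ π) :
    MeasurePreserving (fun ω : (QVec N × QVec N) × QVec N => nextQueue ω.1.1 ω.2 ω.1.2)
      (slotLaw A τ π) π.toMeasure := by
  refine ⟨Measurable.of_discrete, Measure.ext_of_lintegral _ fun g _ => ?_⟩
  rw [lintegral_map Measurable.of_discrete Measurable.of_discrete, slotLaw,
    lintegral_prod _ Measurable.of_discrete.aemeasurable]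
  conv_rhs => rw [← hπ]
  simp only [lintegral_toMeasure_eq_expect, scheduleLaw, expect_bind, expect_map, step]

theorem measurePreserving_arrival :
    MeasurePreserving (fun ω : (QVec N × QVec N) × QVec N => ω.2) (slotLaw A τ π)
      A.toMeasure := measurePreserving_snd

theorem ae_slotLaw (hτ : IsMaxWeightRule τ) :
    ∀ᵐ ω ∂slotLaw A τ π, ω.1.2 ∈ maxWeightSchedules ω.1.1 ∧ ω.2 ∈ A.support := by
  have h1 : ∀ᵐ x ∂(scheduleLaw τ π).toMeasure, x.2 ∈ maxWeightSchedules x.1 := by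
    filter_upwards [ae_mem_support (scheduleLaw τ π)] with x hx
    rw [scheduleLaw, PMF.mem_support_bind_iff] at hx
    obtain ⟨q, -, hq⟩ := hx
    rw [PMF.mem_support_map_iff] at hq
    obtain ⟨s, hs, rfl⟩ := hq
    exact hτ q hs
  filter_upwards [Measure.quasiMeasurePreserving_fst.ae h1,
    (measurePreserving_arrival (τ := τ) (π := π)).quasiMeasurePreserving.ae (ae_mem_support A)]
    with ω h h' using ⟨h, h'⟩

theorem measurePreserving_fst_scheduleLaw :
    MeasurePreserving Prod.fst (scheduleLaw τ π).toMeasure π.toMeasure := by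
  refine ⟨Measurable.of_discrete, Measure.ext_of_lintegral _ fun g _ => ?_⟩
  rw [lintegral_map Measurable.of_discrete Measurable.of_discrete]
  simp only [lintegral_toMeasure_eq_expect, scheduleLaw, expect_bind, expect_map, expect_const]

/-- Arrivals are independent of the queue lengths. -/
theorem hasMean_queue_mul_arrival {g h : QVec N → ℝ} (hg : Integrable g π.toMeasure)
    (hh : Integrable h A.toMeasure) :
    HasMean (slotLaw A τ π) (fun ω => g ω.1.1 * h ω.2)
      ((∫ q, g q ∂π.toMeasure) * ∫ a, h a ∂A.toMeasure) := by
  have hm := HasMean.comp (measurePreserving_fst_scheduleLaw (τ := τ)) hg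
  refine ⟨hm.1.mul_prod hh, ?_⟩
  rw [slotLaw, integral_prod_mul (fun x : QVec N × QVec N => g x.1) h, hm.2]

theorem integrable_queue_mul_queue
    (h2 : Integrable (fun q => toReal q ⬝ᵥ toReal q) π.toMeasure) (p r : Fin N × Fin N) :
    Integrable (fun q : QVec N => (q p : ℝ) * q r) π.toMeasure := by
  refine h2.mono' Measurable.of_discrete.aestronglyMeasurable (Eventually.of_forall fun q => ?_)
  have h1 := sq_le_dotProduct_self (toReal q) p
  have h3 := sq_le_dotProduct_self (toReal q) r
  simp only [toReal_apply] at h1 h3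
  rw [Real.norm_of_nonneg (by positivity)]
  nlinarith [sq_nonneg ((q p : ℝ) - q r)]

theorem integrable_queue
    (h2 : Integrable (fun q => toReal q ⬝ᵥ toReal q) π.toMeasure) (p : Fin N × Fin N) :
    Integrable (fun q : QVec N => (q p : ℝ)) π.toMeasure := by
  refine h2.mono' Measurable.of_discrete.aestronglyMeasurable (Eventually.of_forall fun q => ?_)
  have h1 := sq_le_dotProduct_self (toReal q) p
  simp only [toReal_apply] at h1
  rw [Real.norm_of_nonneg (by positivity)]
  have : (q p : ℝ) ≤ q p ^ 2 := by exact_mod_cast Nat.le_self_pow two_ne_zero _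
  linarith

theorem integrable_total
    (h2 : Integrable (fun q => toReal q ⬝ᵥ toReal q) π.toMeasure) :
    Integrable (fun q : QVec N => total (toReal q)) π.toMeasure :=
  integrable_finsetSum _ fun p _ => integrable_queue h2 p

theorem integrable_portForm_queue
    (h2 : Integrable (fun q => toReal q ⬝ᵥ toReal q) π.toMeasure) :
    Integrable (fun q : QVec N => portForm (toReal q) (toReal q)) π.toMeasure := by
  simp only [portForm_eq_sum]
  exact integrable_finsetSum _ fun p _ => integrable_finsetSum _ fun r _ =>
    (integrable_queue_mul_queue h2 p r).const_mul _

variable {ν : Fin N × Fin N → ℝ} {Amax : ℕ} {ε : ℝ}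

theorem integrable_arrival_mul (hbdd : ∀ a ∈ A.support, ∀ p, a p ≤ Amax) (p r : Fin N × Fin N) :
    Integrable (fun a : QVec N => (a p : ℝ) * a r) A.toMeasure :=
  integrable_of_bounded (Amax * Amax : ℕ) ((ae_mem_support A).mono fun a ha => by
    rw [← Nat.cast_mul, Nat.abs_cast]
    exact_mod_cast Nat.mul_le_mul (hbdd a ha p) (hbdd a ha r))

theorem integral_arrival_mul (hbdd : ∀ a ∈ A.support, ∀ p, a p ≤ Amax)
    (hmean : ∀ p, ∫ a, (a p : ℝ) ∂A.toMeasure = (1 - ε) * ν p) (p r : Fin N × Fin N) :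
    ∫ a, (a p : ℝ) * a r ∂A.toMeasure =
      covariance (fun a : QVec N => (a p : ℝ)) (fun a : QVec N => (a r : ℝ)) A.toMeasure
        + (1 - ε) ^ 2 * (ν p * ν r) := by
  have hL : ∀ p, MemLp (fun a : QVec N => (a p : ℝ)) 2 A.toMeasure := fun p =>
    MemLp.of_bound Measurable.of_discrete.aestronglyMeasurable Amax
      ((ae_mem_support A).mono fun a ha => by
        rw [Real.norm_natCast]; exact_mod_cast hbdd a ha p)
  rw [covariance_eq_sub (hL p) (hL r), hmean, hmean]
  simp only [Pi.mul_apply]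
  ring

theorem integral_total_arrival (hbdd : ∀ a ∈ A.support, ∀ p, a p ≤ Amax)
    (hmean : ∀ p, ∫ a, (a p : ℝ) ∂A.toMeasure = (1 - ε) * ν p) (hν : IsBistochastic ν) :
    ∫ a, total (toReal a) ∂A.toMeasure = (1 - ε) * N := by
  simp only [total, toReal_apply]
  rw [integral_finsetSum _ fun p _ => integrable_arrival hbdd p, ← hν.total_eq, total,
    Finset.mul_sum]
  exact Finset.sum_congr rfl fun p _ => hmean p

theorem integrable_total_arrival (hbdd : ∀ a ∈ A.support, ∀ p, a p ≤ Amax) :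
    Integrable (fun a : QVec N => total (toReal a)) A.toMeasure :=
  integrable_finsetSum _ fun p _ => integrable_arrival hbdd p

theorem integral_portForm_arrival (hN : 1 ≤ N) (hbdd : ∀ a ∈ A.support, ∀ p, a p ≤ Amax)
    (hmean : ∀ p, ∫ a, (a p : ℝ) ∂A.toMeasure = (1 - ε) * ν p) (hν : IsBistochastic ν) :
    ∫ a, portForm (toReal a) (toReal a) ∂A.toMeasure =
      ∑ p, ∑ r, portMatrix N p r * covariance (fun a : QVec N => (a p : ℝ))
        (fun a : QVec N => (a r : ℝ)) A.toMeasure + (1 - ε) ^ 2 := by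
  have hN' : (N : ℝ) ≠ 0 := by positivity
  have h1 : portForm ν ν = 1 := by
    rw [portForm_of_isBistochastic hN ν hν, hν.total_eq, inv_mul_cancel₀ hN']
  have hi := fun p r => (integrable_arrival_mul hbdd p r).const_mul (portMatrix N p r)
  simp only [portForm_eq_sum, toReal_apply]
  rw [integral_finsetSum _ fun p _ => integrable_finsetSum _ fun r _ => hi p r]
  have h2 : (1 - ε) ^ 2 = ∑ p, ∑ r, portMatrix N p r * ((1 - ε) ^ 2 * (ν p * ν r)) := by
    calc (1 - ε) ^ 2 = (1 - ε) ^ 2 * portForm ν ν := by rw [h1, mul_one]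
      _ = _ := by
        simp only [portForm_eq_sum, Finset.mul_sum]
        exact Finset.sum_congr rfl fun p _ => Finset.sum_congr rfl fun r _ => by ring
  rw [h2, ← Finset.sum_add_distrib]
  refine Finset.sum_congr rfl fun p _ => ?_
  rw [integral_finsetSum _ fun r _ => hi p r, ← Finset.sum_add_distrib]
  refine Finset.sum_congr rfl fun r _ => ?_
  rw [integral_const_mul, integral_arrival_mul hbdd hmean]
  ring

/-- The mean of the idle service vanishes with the heavy traffic parameter. -/
theorem integral_total_idle (hτ : IsMaxWeightRule τ) (hbdd : ∀ a ∈ A.support, ∀ p, a p ≤ Amax)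
    (hmean : ∀ p, ∫ a, (a p : ℝ) ∂A.toMeasure = (1 - ε) * ν p) (hν : IsBistochastic ν)
    (hπ : IsSteadyState A τ π)
    (h2 : Integrable (fun q => toReal q ⬝ᵥ toReal q) π.toMeasure) :
    ∫ ω, total (idle ω.1.1 ω.2 ω.1.2) ∂slotLaw A τ π = N * ε := by
  have hT := integrable_total h2
  have h := (((HasMean.comp (measurePreserving_nextQueue hπ) hT).sub
    (HasMean.comp (measurePreserving_queue (A := A) (τ := τ)) hT)).sub
    (HasMean.comp (measurePreserving_arrival (τ := τ) (π := π))
      (integrable_total_arrival hbdd))).add (HasMean.const (N : ℝ))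
  rw [integral_congr_ae ((ae_slotLaw hτ).mono fun ω h => total_idle ω.1.1 ω.2 ω.1.2 h.1.1),
    h.integral_eq, integral_total_arrival hbdd hmean hν]
  ring

theorem portForm_sub_fill_left (hN : 1 ≤ N) {s : QVec N} (hs : s ∈ schedules N) (q a : QVec N) :
    portForm (toReal q) (toReal a - fill (toReal s)) =
      ∑ p, (portMatrix N *ᵥ toReal q) p * a p - (N : ℝ)⁻¹ * total (toReal q) := by
  rw [portForm_sub_right, portForm_of_isBistochastic hN _
    (isSubstochastic_of_mem_schedules hs).isBistochastic_fill, portForm_comm, portForm,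
    dotProduct_comm]
  rfl

theorem portForm_sub_fill_self (hN : 1 ≤ N) {s : QVec N} (hs : s ∈ schedules N) (a : QVec N) :
    portForm (toReal a - fill (toReal s)) (toReal a - fill (toReal s)) =
      portForm (toReal a) (toReal a) - 2 * (N : ℝ)⁻¹ * total (toReal a) + 1 := by
  have hN' : (N : ℝ) ≠ 0 := by positivity
  have hf := (isSubstochastic_of_mem_schedules hs).isBistochastic_fill
  rw [portForm_sub_right, portForm_of_isBistochastic hN _ hf, portForm_sub_left,
    portForm_comm (fill (toReal s)), portForm_of_isBistochastic hN _ hf]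
  have e : total (toReal a - fill (toReal s)) = total (toReal a) - total (fill (toReal s)) := by
    simp only [total, Pi.sub_apply, Finset.sum_sub_distrib]
  rw [e, hf.total_eq]
  field_simp
  ring

/-- Stationarity of the quadratic form, and the mean of its idle term. -/
theorem integral_idleTerm (hN : 1 ≤ N) (hτ : IsMaxWeightRule τ)
    (hbdd : ∀ a ∈ A.support, ∀ p, a p ≤ Amax)
    (hmean : ∀ p, ∫ a, (a p : ℝ) ∂A.toMeasure = (1 - ε) * ν p) (hν : IsBistochastic ν)
    (hπ : IsSteadyState A τ π)
    (h2 : Integrable (fun q => toReal q ⬝ᵥ toReal q) π.toMeasure) :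
    ∫ ω, idleTerm ω.1.1 ω.2 ω.1.2 ∂slotLaw A τ π =
      2 / N * (ε * ∫ q, total (toReal q) ∂π.toMeasure)
        - ∑ p, ∑ r, portMatrix N p r * covariance (fun a : QVec N => (a p : ℝ))
          (fun a : QVec N => (a r : ℝ)) A.toMeasure - ε ^ 2 := by
  have hN' : (N : ℝ) ≠ 0 := by positivity
  have hG := integrable_portForm_queue h2
  have hT := integrable_total h2
  have hP : ∀ p, Integrable (fun q => (portMatrix N *ᵥ toReal q) p) π.toMeasure := fun p =>
    integrable_finsetSum _ fun r _ => (integrable_queue h2 r).const_mul _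
  have hGA : Integrable (fun a : QVec N => portForm (toReal a) (toReal a)) A.toMeasure := by
    simp only [portForm_eq_sum]
    exact integrable_finsetSum _ fun p _ => integrable_finsetSum _ fun r _ =>
      (integrable_arrival_mul hbdd p r).const_mul _
  have h3 : HasMean (slotLaw A τ π)
      (fun ω => ∑ p, (portMatrix N *ᵥ toReal ω.1.1) p * (ω.2 p : ℝ))
      ((1 - ε) * ((N : ℝ)⁻¹ * ∫ q, total (toReal q) ∂π.toMeasure)) := by
    have h := HasMean.sum fun p =>
      hasMean_queue_mul_arrival (τ := τ) (hP p) (integrable_arrival hbdd p)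
    convert h using 1
    have h1 : ∀ p, (∫ q, (portMatrix N *ᵥ toReal q) p ∂π.toMeasure) *
        ∫ a, (a p : ℝ) ∂A.toMeasure =
        (1 - ε) * ∫ q, (portMatrix N *ᵥ toReal q) p * ν p ∂π.toMeasure := fun p => by
      rw [hmean, integral_mul_const]
      ring
    simp only [h1]
    rw [← Finset.mul_sum, ← integral_finsetSum _ fun p _ => (hP p).mul_const _,
      ← integral_const_mul (N : ℝ)⁻¹]
    congr 2
    funext q
    rw [← portForm_of_isBistochastic hN _ hν, portForm_comm, portForm, dotProduct_comm]
    rfl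
  have h := (((HasMean.comp (measurePreserving_nextQueue hπ) hG).sub
    (HasMean.comp (measurePreserving_queue (A := A) (τ := τ)) hG)).sub
    ((h3.sub ((HasMean.comp (measurePreserving_queue (A := A) (τ := τ)) hT).const_mul
      (N : ℝ)⁻¹)).const_mul 2)).sub
    (((HasMean.comp (measurePreserving_arrival (τ := τ) (π := π)) hGA).sub
      ((HasMean.comp (measurePreserving_arrival (τ := τ) (π := π))
        (integrable_total_arrival hbdd)).const_mul (2 * (N : ℝ)⁻¹))).add (HasMean.const 1))
  have e : ∀ᵐ ω ∂slotLaw A τ π, idleTerm ω.1.1 ω.2 ω.1.2 =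
      portForm (toReal (nextQueue ω.1.1 ω.2 ω.1.2)) (toReal (nextQueue ω.1.1 ω.2 ω.1.2))
        - portForm (toReal ω.1.1) (toReal ω.1.1)
        - 2 * (∑ p, (portMatrix N *ᵥ toReal ω.1.1) p * ω.2 p - (N : ℝ)⁻¹ * total (toReal ω.1.1))
        - (portForm (toReal ω.2) (toReal ω.2) - 2 * (N : ℝ)⁻¹ * total (toReal ω.2) + 1) :=
    (ae_slotLaw hτ).mono fun ω h => by
      rw [idleTerm, portForm_sub_fill_left hN h.1.1, portForm_sub_fill_self hN h.1.1]
  rw [integral_congr_ae e, h.integral_eq, integral_total_arrival hbdd hmean hν,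
    integral_portForm_arrival hN hbdd hmean hν]
  field_simp
  ring

theorem abs_integral_idleTerm_le (hN : 1 ≤ N) (hτ : IsMaxWeightRule τ)
    (hbdd : ∀ a ∈ A.support, ∀ p, a p ≤ Amax)
    (hmean : ∀ p, ∫ a, (a p : ℝ) ∂A.toMeasure = (1 - ε) * ν p) (hν : IsBistochastic ν)
    (hε : 0 < ε) (hπ : IsSteadyState A τ π)
    (h2 : Integrable (fun q => toReal q ⬝ᵥ toReal q) π.toMeasure) {K : ℝ}
    (hi : Integrable (fun q => perpNorm q ^ 2) π.toMeasure)
    (hK : ∫ q, perpNorm q ^ 2 ∂π.toMeasure ≤ K) :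
    |∫ ω, idleTerm ω.1.1 ω.2 ω.1.2 ∂slotLaw A τ π| ≤
      (2 * Amax + 3) * (N * ε) + 4 * (K + N ^ 3) * √ε := by
  have hs : 0 < √ε := Real.sqrt_pos.2 hε
  have hidle : ∀ᵐ ω ∂slotLaw A τ π, 0 ≤ total (idle ω.1.1 ω.2 ω.1.2) ∧
      total (idle ω.1.1 ω.2 ω.1.2) ≤ N ^ 2 := (ae_slotLaw hτ).mono fun ω h => by
    refine ⟨Finset.sum_nonneg fun p _ => idle_nonneg h.1.1 p, ?_⟩
    refine (Finset.sum_le_sum fun p _ => idle_le_one h.1.1 p).trans (le_of_eq ?_)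
    simp [pow_two]
  have i1 : Integrable (fun ω : (QVec N × QVec N) × QVec N => total (idle ω.1.1 ω.2 ω.1.2))
      (slotLaw A τ π) := integrable_of_bounded (N ^ 2) (hidle.mono fun ω h => by
        rw [abs_of_nonneg h.1]; exact h.2)
  have h3 := ((HasMean.mk i1 (integral_total_idle hτ hbdd hmean hν hπ h2)).const_mul
    (2 * Amax + 3 + 4 * N ^ 2 / √ε)).add
    ((HasMean.comp (measurePreserving_nextQueue hπ) hi).const_mul (4 * √ε))
  have hle : ∀ᵐ ω ∂slotLaw A τ π, ‖idleTerm ω.1.1 ω.2 ω.1.2‖ ≤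
      (2 * Amax + 3 + 4 * N ^ 2 / √ε) * total (idle ω.1.1 ω.2 ω.1.2)
        + 4 * √ε * perpNorm (nextQueue ω.1.1 ω.2 ω.1.2) ^ 2 := by
    filter_upwards [ae_slotLaw hτ, hidle] with ω h hω
    refine (abs_idleTerm_le hN h.1 (hbdd _ h.2)).trans ?_
    set n := perpNorm (nextQueue ω.1.1 ω.2 ω.1.2)
    set T := total (idle ω.1.1 ω.2 ω.1.2)
    have h1 : 8 * n * T ≤ 4 * √ε * n ^ 2 + 4 * T ^ 2 / √ε := by
      have : 0 ≤ 4 / √ε * (√ε * n - T) ^ 2 := by positivity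
      have e : 4 / √ε * (√ε * n - T) ^ 2 = 4 * √ε * n ^ 2 + 4 * T ^ 2 / √ε - 8 * n * T := by
        field_simp
        ring
      linarith
    have h3 : 4 * T ^ 2 / √ε ≤ 4 * N ^ 2 / √ε * T := by
      rw [div_mul_eq_mul_div]
      have : T ^ 2 ≤ N ^ 2 * T := by rw [pow_two]; exact mul_le_mul_of_nonneg_right hω.2 hω.1
      gcongr ?_ / _
      linarith
    linarith
  rw [← Real.norm_eq_abs]
  refine (norm_integral_le_of_norm_le h3.integrable hle).trans ?_
  rw [h3.integral_eq]
  have h1 : 4 * √ε * ∫ q, perpNorm q ^ 2 ∂π.toMeasure ≤ 4 * √ε * K := by gcongr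
  have h3 : 4 * (N : ℝ) ^ 2 / √ε * (N * ε) = 4 * N ^ 3 * √ε := by
    have : ε = √ε * √ε := (Real.mul_self_sqrt hε.le).symm
    rw [div_mul_eq_mul_div, div_eq_iff hs.ne', mul_assoc (4 * (N : ℝ) ^ 3), ← this]
    ring
  rw [add_mul, h3]
  linarith

end

end InputQueuedSwitch

theorem corollary1 (N : ℕ) (hN : 1 ≤ N)
    -- the limiting rate vector: positive, and completely saturated
    (ν : Fin N × Fin N → ℝ) (hν_pos : ∀ p, 0 < ν p)
    (hν_row : ∀ i, ∑ j, ν (i, j) = 1) (hν_col : ∀ j, ∑ i, ν (i, j) = 1)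
    -- for each parameter: the law of the arrivals in a time slot, and a MaxWeight rule
    (A : ℝ → PMF (InputQueuedSwitch.QVec N))
    (τ : ℝ → InputQueuedSwitch.QVec N → PMF (InputQueuedSwitch.QVec N))
    (hτ : ∀ ε ∈ Set.Ioo (0 : ℝ) 1, InputQueuedSwitch.IsMaxWeightRule (τ ε))
    (Amax : ℕ)
    (hA_bdd : ∀ ε ∈ Set.Ioo (0 : ℝ) 1, ∀ a ∈ (A ε).support, ∀ p, a p ≤ Amax)
    (hA_mean : ∀ ε ∈ Set.Ioo (0 : ℝ) 1, ∀ p,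
      ∫ a, (a p : ℝ) ∂(A ε).toMeasure = (1 - ε) * ν p)
    (Sig : Matrix (Fin N × Fin N) (Fin N × Fin N) ℝ)
    (hA_cov : ∀ p r, Tendsto
      (fun ε : ℝ => covariance (fun a : InputQueuedSwitch.QVec N => (a p : ℝ))
        (fun a : InputQueuedSwitch.QVec N => (a r : ℝ)) (A ε).toMeasure)
      (𝓝[>] 0) (𝓝 (Sig p r))) :
    -- steady-state laws exist, and the limit holds for them
    (∀ ε ∈ Set.Ioo (0 : ℝ) 1, ∃ π₀, InputQueuedSwitch.IsSteadyState (A ε) (τ ε) π₀) ∧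
    ∀ π : ℝ → PMF (InputQueuedSwitch.QVec N),
      (∀ ε ∈ Set.Ioo (0 : ℝ) 1, InputQueuedSwitch.IsSteadyState (A ε) (τ ε) (π ε)) →
      (∀ ε ∈ Set.Ioo (0 : ℝ) 1,
        Integrable (fun q : InputQueuedSwitch.QVec N => ∑ p, (q p : ℝ)) (π ε).toMeasure) ∧
      Tendsto (fun ε : ℝ => ε * ∫ q, ∑ p, (q p : ℝ) ∂(π ε).toMeasure) (𝓝[>] 0)
        (𝓝 (1 / (2 * (N : ℝ)) * ∑ p,
          ((2 * (N : ℝ) - 1) * Sig p p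
            + ((N : ℝ) - 1) * ∑ r ∈ InputQueuedSwitch.row p ∪ InputQueuedSwitch.col p, Sig p r
            - ∑ r ∈ InputQueuedSwitch.other p, Sig p r))) := by
  have hN' : (N : ℝ) ≠ 0 := by positivity
  have hν : InputQueuedSwitch.IsBistochastic ν := ⟨fun p => (hν_pos p).le, hν_row, hν_col⟩
  have : Nonempty (Fin N × Fin N) := ⟨(⟨0, hN⟩, ⟨0, hN⟩)⟩
  obtain ⟨p₀, hp₀⟩ := Finite.exists_min ν
  have hδ := hν_pos p₀
  refine ⟨fun ε hε => InputQueuedSwitch.exists_isSteadyState (hτ ε hε) (hA_bdd ε hε)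
    (hA_mean ε hε) hν hδ hp₀ hε.1, fun π hπ => ?_⟩
  have h2 := fun ε (hε : ε ∈ Set.Ioo (0 : ℝ) 1) =>
    InputQueuedSwitch.integrable_dotProduct_self (hτ ε hε) (hA_bdd ε hε)
      (hA_mean ε hε) hν hδ hp₀ hε.1 (hπ ε hε)
  refine ⟨fun ε hε => InputQueuedSwitch.integrable_total (h2 ε hε), ?_⟩
  obtain ⟨K, -, hK⟩ := InputQueuedSwitch.exists_integral_perpNorm_sq_le N Amax hδ
  set R : ℝ → ℝ := fun ε => ∫ ω, InputQueuedSwitch.idleTerm ω.1.1 ω.2 ω.1.2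
    ∂InputQueuedSwitch.slotLaw (A ε) (τ ε) (π ε)
  have hsmall : ∀ᶠ ε : ℝ in 𝓝[>] 0, ε ∈ Set.Ioo (0 : ℝ) 1 ∧ ε * N ≤ ν p₀ / 2 := by
    have hpos : (0 : ℝ) < min 1 (ν p₀ / 2 / N) := lt_min one_pos (by positivity)
    filter_upwards [Ioo_mem_nhdsGT hpos] with ε hε
    refine ⟨⟨hε.1, hε.2.trans_le (min_le_left _ _)⟩, ?_⟩
    rw [← le_div_iff₀ (by positivity)]
    exact hε.2.le.trans (min_le_right _ _)
  have hRle : ∀ᶠ ε : ℝ in 𝓝[>] 0, ‖R ε‖ ≤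
      (2 * Amax + 3) * (N * ε) + 4 * (K + N ^ 3) * √ε := by
    filter_upwards [hsmall] with ε hε
    obtain ⟨hi, hle⟩ := hK (A ε) (τ ε) ν ε (π ε) (hτ ε hε.1) (hA_bdd ε hε.1) (hA_mean ε hε.1) hν
      hp₀ hε.1.1.le hε.2 (hπ ε hε.1)
    exact InputQueuedSwitch.abs_integral_idleTerm_le hN (hτ ε hε.1) (hA_bdd ε hε.1)
      (hA_mean ε hε.1) hν hε.1.1 (hπ ε hε.1) (h2 ε hε.1) hi hle
  have hcont : ∀ f : ℝ → ℝ, Continuous f → Tendsto f (𝓝[>] 0) (𝓝 (f 0)) := fun f hf =>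
    (hf.tendsto 0).mono_left nhdsWithin_le_nhds
  have hR : Tendsto R (𝓝[>] 0) (𝓝 0) := by
    refine squeeze_zero_norm' hRle ?_
    have h := hcont (fun ε => (2 * Amax + 3) * (N * ε) + 4 * (K + N ^ 3) * √ε) (by fun_prop)
    simpa using h
  have hcov : Tendsto (fun ε : ℝ => ∑ p, ∑ r, InputQueuedSwitch.portMatrix N p r *
      covariance (fun a : InputQueuedSwitch.QVec N => (a p : ℝ))
        (fun a : InputQueuedSwitch.QVec N => (a r : ℝ)) (A ε).toMeasure) (𝓝[>] 0)
      (𝓝 (∑ p, ∑ r, InputQueuedSwitch.portMatrix N p r * Sig p r)) :=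
    tendsto_finsetSum _ fun p _ => tendsto_finsetSum _ fun r _ => (hA_cov p r).const_mul _
  have hsq : Tendsto (fun ε : ℝ => ε ^ 2) (𝓝[>] 0) (𝓝 0) := by
    have h : Tendsto (fun ε : ℝ => ε ^ 2) (𝓝[>] 0) (𝓝 ((0 : ℝ) ^ 2)) :=
      hcont (fun ε => ε ^ 2) (by fun_prop)
    rwa [zero_pow two_ne_zero] at h
  have hlim := ((hR.add hcov).add hsq).const_mul ((N : ℝ) / 2)
  rw [zero_add, add_zero, InputQueuedSwitch.sum_portMatrix_mul hN] at hlim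
  refine hlim.congr' ?_
  filter_upwards [hsmall] with ε hε
  have h := InputQueuedSwitch.integral_idleTerm hN (hτ ε hε.1) (hA_bdd ε hε.1)
    (hA_mean ε hε.1) hν (hπ ε hε.1) (h2 ε hε.1)
  change N / 2 * ((∫ ω, InputQueuedSwitch.idleTerm ω.1.1 ω.2 ω.1.2
    ∂InputQueuedSwitch.slotLaw (A ε) (τ ε) (π ε)) + _ + _) =
      ε * ∫ q, InputQueuedSwitch.total (InputQueuedSwitch.toReal q) ∂(π ε).toMeasure
  rw [h]
  field_simp
  ring
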